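/- Let $X\in\mathbb R^{n\times p}$ ($n\ge 1$) be a fixed matrix with columns $X_1,\dots,X_p$, let $\beta^0\in\mathbb R^p$, and let $Y=X\beta^0+\epsilon$, where $\epsilon\in\mathbb R^n$ has i.i.d. standard Gaussian entries. Let $S_0:=\{j:\beta^0_j\ne0\}$ and $s_0:=|S_0|$. For $S\subset\{1,\dots,p\}$ write $b_S$ and $b_{-S}$ for the parts of $b\in\mathbb R^p$ with indices in $S$ and outside $S$, and for a vector $w=(w_j)_{j\notin S}$ of non-negative weights, with $W:=\mathrm{diag}(w)$, define the compatibility constant $$\hat\kappa^2(w,S):=\min\Bigl\{|S|\,\|Xb\|_2^2/n:\ \|b_S\|_1-\|Wb_{-S}\|_1=1\Bigr\}$$ ($=+\infty$ if $S=\emptyset$). For $\lambda>0$, a Lasso solution is any $$\hat\beta\in\arg\min_{b\in\mathbb R^p}\bigl\{\|Y-Xb\|_2^2+2\lambda\|b\|_1\bigr\},$$ equivalently any solution of the KKT conditions $X^T(Y-X\hat\beta)=\lambda\hat\zeta$ with $\|\hat\zeta\|_\infty\le1$ and $\hat\zeta^T\hat\beta=\|\hat\beta\|_1$. For $j\notin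 S_0$ let $v_j$ be the Euclidean distance of $X_j$ to the span of $\{X_k:k\in S_0\}$. Let $t>0$ and suppose that $$\lambda>0\quad\text{and}\quad\lambda>v_j\sqrt{2(\log(2p)+t)}\ \ \text{for all }j\notin S_0 .$$ Put $\bar v_j:=v_j\sqrt{2(\log(2p)+t)}/\lambda$ for $j\notin S_0$. (i) Upper bound. For every $x>0$, with probability at least $1-e^{-t}-e^{-x}$ a Lasso solution exists, and every Lasso solution $\hat\beta$ satisfies $$\|X(\hat\beta-\beta^0)\|_2\le\sqrt{\frac{s_0}{\hat\kappa^2(1-\bar v,S_0)}}\sqrt{\frac{\lambda^2}{n}}+\sqrt{s_0}+\sqrt{2x},$$ where the right-hand side is read as $+\infty$ if $\hat\kappa^2(1-\bar v,S_0)=0$, and $s_0/\hat\kappa^2:=0$ if $S_0=\emptyset$. (ii) Joint upper and lower bound. Suppose moreover that $\hat\kappa^2(1+\bar v,S_0)>0$. Let $$b^*\in\arg\min\bigl\{\|Xb\|_2^2:\ \|b_{S_0}\|_1-\|\mathrm{diag}(1+\bar v)\,b_{-S_0}\|_1=1\bigr\}$$ (so that $S_0\ne\emptyset$), and let $z^*_j:=\mathrm{sign}(b^*_j)$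 for $j\in S_0$. Let $\mathcal W:=\{w:1-\bar v_j\le w_j\le1+\bar v_j\ \forall j\notin S_0\}$ and for each $w\in\mathcal W$ let $$b(w)\in\arg\min\bigl\{\|Xb\|_2^2:\ z_{S_0}^{*T}b_{S_0}-\|Wb_{-S_0}\|_1\ge1\bigr\}.$$ For $j\in S_0$ let $\mathbf b_j:=\sup_{w\in\mathcal W}|b_j(w)|/\|Xb(w)\|_2^2\in[0,\infty]$ (with $a/0=\infty$ for $a>0$, and $0/0=0$), and let $\bar u_j:=u_j\sqrt{2(\log(2p)+t)}/\lambda$, where $u_j^2$ is the $j$-th diagonal entry of $(X_{S_0}^TX_{S_0})^{-1}$; this matrix is invertible since $\hat\kappa^2(1+\bar v,S_0)>0$. Assume the betamin condition $$|\beta^0_j|>\lambda(\mathbf b_j+\bar u_j)\quad\text{and}\quad\mathrm{sign}(\beta^0_j)=z^*_j\qquad\text{for all }j\in S_0 .$$ Then for every $x>0$, with probability at least $1-e^{-t}-e^{-x}$ a Lasso solution exists, and every Lasso solution $\hat\beta$ solves the KKT conditions and satisfies both the upper bound in (i) and the lower bound $$\|X(\hat\beta-\beta^0)\|_2\ge\sqrt{\frac{s_0}{\hat\kappa^2(1+\bar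 v,S_0)}}\sqrt{\frac{\lambda^2}{n}}-\sqrt{s_0}-\sqrt{2x}.$$ -/

import Mathlib

open MeasureTheory ProbabilityTheory Matrix
open scoped ENNReal

noncomputable section

namespace LassoBounds

/-- The Euclidean norm `‖y‖₂`. -/
def l2norm {n : ℕ} (y : Fin n → ℝ) : ℝ := ‖WithLp.toLp 2 y‖

/-- The active set `S₀ = {j : β⁰_j ≠ 0}`. -/
def activeSet {p : ℕ} (β0 : Fin p → ℝ) : Finset (Fin p) := {j | β0 j ≠ 0}

/-- The Lasso criterion `‖y - X b‖₂² + 2 λ ‖b‖₁`. -/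
def lassoObjective {n p : ℕ} (X : Matrix (Fin n) (Fin p) ℝ) (y : Fin n → ℝ) (lam : ℝ)
    (b : Fin p → ℝ) : ℝ :=
  l2norm (y - X *ᵥ b) ^ 2 + 2 * lam * ∑ j, |b j|

/-- `b` is a Lasso estimator: a global minimizer of the Lasso criterion. -/
def IsLasso {n p : ℕ} (X : Matrix (Fin n) (Fin p) ℝ) (y : Fin n → ℝ) (lam : ℝ)
    (b : Fin p → ℝ) : Prop :=
  IsMinOn (lassoObjective X y lam) Set.univ b

/-- `b` solves the KKT conditions of the Lasso: `Xᵀ (y - X b) = λ ζ` for some `ζ` in the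
subdifferential `∂‖b‖₁ = {z : ‖z‖_∞ ≤ 1, zᵀ b = ‖b‖₁}`. -/
def IsKKT {n p : ℕ} (X : Matrix (Fin n) (Fin p) ℝ) (y : Fin n → ℝ) (lam : ℝ)
    (b : Fin p → ℝ) : Prop :=
  ∃ ζ : Fin p → ℝ, (∀ j, |ζ j| ≤ 1) ∧ ∑ j, ζ j * b j = ∑ j, |b j| ∧
    Xᵀ *ᵥ (y - X *ᵥ b) = lam • ζ

/-- `‖W b_{-S}‖₁` where `W = diag(w)`, for weights `w` indexed by the complement of `S`. -/
def weightedOff {p : ℕ} (S : Finset (Fin p)) (w : {j // j ∉ S} → ℝ) (b : Fin p → ℝ) : ℝ :=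
  ∑ j : {j // j ∉ S}, |w j * b j|

/-- The constraint set `{b : ‖b_S‖₁ - ‖W b_{-S}‖₁ = 1}`. -/
def compatSet {p : ℕ} (S : Finset (Fin p)) (w : {j // j ∉ S} → ℝ) : Set (Fin p → ℝ) :=
  {b | ∑ j ∈ S, |b j| - weightedOff S w b = 1}

/-- The squared empirical compatibility constant
`κ̂²(w, S) = min {|S| ‖X b‖₂² / n : ‖b_S‖₁ - ‖W b_{-S}‖₁ = 1}`
(with value `∞` if no `b` satisfies the constraint, which happens for `S = ∅`). -/
def kappaSq {n p : ℕ} (X : Matrix (Fin n) (Fin p) ℝ) (S : Finset (Fin p))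
    (w : {j // j ∉ S} → ℝ) : ℝ≥0∞ :=
  ⨅ b ∈ compatSet S w, ENNReal.ofReal (S.card * l2norm (X *ᵥ b) ^ 2 / n)

/-- The `j`-th column of `X` as a Euclidean vector. -/
def colVec {n p : ℕ} (X : Matrix (Fin n) (Fin p) ℝ) (j : Fin p) : EuclideanSpace ℝ (Fin n) :=
  WithLp.toLp 2 fun i => X i j

/-- The space spanned by the columns of `X_S`. -/
def colSpan {n p : ℕ} (X : Matrix (Fin n) (Fin p) ℝ) (S : Finset (Fin p)) :
    Submodule ℝ (EuclideanSpace ℝ (Fin n)) :=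
  Submodule.span ℝ (colVec X '' (S : Set (Fin p)))

/-- `v_j = ‖X_j - proj(X_j)‖₂`, with `proj` the orthogonal projection on the column space of `X_S`;
so `v_j²` is the `j`-th diagonal entry of `(X_{-S} A X_S)ᵀ (X_{-S} A X_S)`. -/
def vNorm {n p : ℕ} (X : Matrix (Fin n) (Fin p) ℝ) (S : Finset (Fin p)) (j : {j // j ∉ S}) : ℝ :=
  ‖colVec X j - (colSpan X S).starProjection (colVec X j)‖

/-- The submatrix `X_S` of the columns in `S`. -/
def colSub {n p : ℕ} (X : Matrix (Fin n) (Fin p) ℝ) (S : Finset (Fin p)) :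
    Matrix (Fin n) {j // j ∈ S} ℝ :=
  X.submatrix id Subtype.val

/-- `u_j`, the square root of the `j`-th diagonal entry of `(X_Sᵀ X_S)⁻¹`. -/
def uNorm {n p : ℕ} (X : Matrix (Fin n) (Fin p) ℝ) (S : Finset (Fin p)) (j : {j // j ∈ S}) : ℝ :=
  √(((colSub X S)ᵀ * colSub X S)⁻¹ j j)

/-- The noise level `√(2 (log(2p) + t))`. -/
def noiseLevel (p : ℕ) (t : ℝ) : ℝ := √(2 * (Real.log (2 * p) + t))

/-- `v̄_j = v_j √(2 (log(2p) + t)) / λ`, for `j ∉ S`. -/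
def vBar {n p : ℕ} (X : Matrix (Fin n) (Fin p) ℝ) (S : Finset (Fin p)) (t lam : ℝ)
    (j : {j // j ∉ S}) : ℝ :=
  vNorm X S j * noiseLevel p t / lam

/-- `ū_j = u_j √(2 (log(2p) + t)) / λ`, for `j ∈ S`. -/
def uBar {n p : ℕ} (X : Matrix (Fin n) (Fin p) ℝ) (S : Finset (Fin p)) (t lam : ℝ)
    (j : {j // j ∈ S}) : ℝ :=
  uNorm X S j * noiseLevel p t / lam

/-- `b* ∈ argmin {‖X b‖₂² : ‖b_S‖₁ - ‖W b_{-S}‖₁ = 1}`. -/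
def IsCompatMinimizer {n p : ℕ} (X : Matrix (Fin n) (Fin p) ℝ) (S : Finset (Fin p))
    (w : {j // j ∉ S} → ℝ) (bstar : Fin p → ℝ) : Prop :=
  bstar ∈ compatSet S w ∧ IsMinOn (fun b => l2norm (X *ᵥ b) ^ 2) (compatSet S w) bstar

/-- The weights `𝒲(v̄) = {w : 1 - v̄_j ≤ w_j ≤ 1 + v̄_j for all j ∉ S}`. -/
def weightSet {p : ℕ} {S : Finset (Fin p)} (v : {j // j ∉ S} → ℝ) : Set ({j // j ∉ S} → ℝ) :=
  {w | ∀ j, 1 - v j ≤ w j ∧ w j ≤ 1 + v j}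

/-- The convex constraint set `{b : z_Sᵀ b_S - ‖W b_{-S}‖₁ ≥ 1}`. -/
def signedSet {p : ℕ} (S : Finset (Fin p)) (z : Fin p → ℝ) (w : {j // j ∉ S} → ℝ) :
    Set (Fin p → ℝ) :=
  {b | 1 ≤ ∑ j ∈ S, z j * b j - weightedOff S w b}

/-- `b(w) ∈ argmin {‖X b‖₂² : z_Sᵀ b_S - ‖W b_{-S}‖₁ ≥ 1}`. -/
def IsSignedMinimizer {n p : ℕ} (X : Matrix (Fin n) (Fin p) ℝ) (S : Finset (Fin p))
    (z : Fin p → ℝ) (w : {j // j ∉ S} → ℝ) (bw : Fin p → ℝ) : Prop :=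
  bw ∈ signedSet S z w ∧ IsMinOn (fun b => l2norm (X *ᵥ b) ^ 2) (signedSet S z w) bw

/-- `𝐛_j(v̄) = sup_{w ∈ 𝒲(v̄)} |b_j(w)| / ‖X b(w)‖₂²`, for a choice `w ↦ b(w)` of minimizers
(an extended number: a positive number divided by `0` is `∞`). -/
def bBold {n p : ℕ} (X : Matrix (Fin n) (Fin p) ℝ) {S : Finset (Fin p)} (v : {j // j ∉ S} → ℝ)
    (b : ({j // j ∉ S} → ℝ) → Fin p → ℝ) (j : Fin p) : ℝ≥0∞ :=
  ⨆ w ∈ weightSet v, ENNReal.ofReal |b w j| / ENNReal.ofReal (l2norm (X *ᵥ b w) ^ 2)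

/-- The betamin condition for the noisy case with active set `S`, for given choices of `b*(v̄)` and of
`w ↦ b(w)`: `|β⁰_j| > λ (𝐛_j(v̄) + ū_j)` and `sign(β⁰_j) = sign(b*_j(v̄))` for all `j ∈ S`. -/
def Betamin {n p : ℕ} (X : Matrix (Fin n) (Fin p) ℝ) (S : Finset (Fin p)) (β0 : Fin p → ℝ)
    (t lam : ℝ) (bstar : Fin p → ℝ) (b : ({j // j ∉ S} → ℝ) → Fin p → ℝ) : Prop :=
  ∀ j : {j // j ∈ S},
    ENNReal.ofReal lam * (bBold X (vBar X S t lam) b j + ENNReal.ofReal (uBar X S t lam j))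
      < ENNReal.ofReal |β0 j| ∧
    Real.sign (β0 j) = Real.sign (bstar j)

/-- `√(|S| / κ̂²(w, S)) √(λ² / n)`, an extended number (equal to `∞` if `κ̂²(w, S) = 0`, and to `0`
if `S = ∅`). -/
def rate {n p : ℕ} (X : Matrix (Fin n) (Fin p) ℝ) (S : Finset (Fin p))
    (w : {j // j ∉ S} → ℝ) (lam : ℝ) : ℝ≥0∞ :=
  ((S.card : ℝ≥0∞) / kappaSq X S w) ^ (1 / 2 : ℝ) * ENNReal.ofReal √(lam ^ 2 / n)

end LassoBounds

end

open LassoBounds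

/-! Let `P` project onto the span of the active columns and split the noise as `e = Pe + (e - Pe)`.
A Chernoff bound gives `‖Pe‖ ≤ √s₀ + √(2x)`. A union bound over `p` linear functionals, each failing
with probability at most `exp(-t)/p`, keeps the correlation of `e - Pe` with each inactive column
below `λ v̄_j` (`exists_noise_event`). The rest is deterministic.

Upper bound: testing the first-order conditions against `d = b - β0` gives `‖Xd‖² ≤ ‖Pe‖ ‖Xd‖ +
λ(‖d_S‖₁ - ‖(1 - v̄) d_{-S}‖₁)` (`IsLasso.basic_inequality`). Divide by `‖Xd‖` and use the
homogeneity of the compatibility constant.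

Lower bound: `Pe = Xa` with `a` supported on `S`, so `Pe` can be absorbed into the signal `β = β0 +
a`, leaving noise orthogonal to the active columns. For weights `w` read off from the Lasso
solution, its error and the rescaled minimizer `h = λ b(w)/‖X b(w)‖²` satisfy matching variational
inequalities. The betamin condition makes the signs of `z*` a subgradient at `β - h` on `S`, and
monotonicity of the subdifferential of `‖·‖₁` forces `X(β - b) = Xh`, that is `‖X(b - β)‖ = λ/‖X
b(w)‖` (`IsLasso.exists_weight_norm_eq`). As `w ≤ 1 + v̄`, `b*` is feasible for `b(w)`'s problem, so
`‖X b(w)‖ ≤ ‖X b*‖`; the triangle inequality returns to `β0` at cost `‖Pe‖`. -/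

namespace LassoBounds

/-! ### Tail bounds for standard Gaussian vectors. -/

section Gaussian

variable {E : Type*} [NormedAddCommGroup E] [InnerProductSpace ℝ E] [FiniteDimensional ℝ E]
  [MeasurableSpace E] [BorelSpace E]

/-- A linear functional of a standard Gaussian vector is a centred Gaussian variable. -/
lemma map_inner_stdGaussian (c : E) :
    (stdGaussian E).map (fun y => inner ℝ c y) = gaussianReal 0 (‖c‖ ^ 2).toNNReal := by
  have h := IsGaussian.map_eq_gaussianReal (μ := stdGaussian E) (innerSL ℝ c)
  rw [integral_strongDual_stdGaussian, variance_dual_stdGaussian, innerSL_apply_norm] at h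
  exact h

lemma hasSubgaussianMGF_inner_stdGaussian (c : E) :
    HasSubgaussianMGF (fun y => inner ℝ c y) (‖c‖ ^ 2).toNNReal (stdGaussian E) where
  integrable_exp_mul t := by
    have h := integrable_exp_mul_gaussianReal (μ := 0) (v := (‖c‖ ^ 2).toNNReal) t
    rw [← map_inner_stdGaussian] at h
    exact h.comp_measurable (by fun_prop)
  mgf_le t := by
    rw [mgf_gaussianReal (map_inner_stdGaussian c)]
    simp

/-- Chernoff on both sides. The strict inequality makes the event empty for `c = 0`, as happens for
an inactive column lying in the active span. -/
lemma stdGaussian_abs_inner_tail (c : E) {L : ℝ} (hL : 0 ≤ L) :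
    (stdGaussian E).real {y | ‖c‖ * L < |inner ℝ c y|} ≤ 2 * Real.exp (-L ^ 2 / 2) := by
  rcases eq_or_ne c 0 with rfl | hc
  · simpa using (Real.exp_pos _).le
  have hc' : 0 < ‖c‖ := norm_pos_iff.2 hc
  have hsub := hasSubgaussianMGF_inner_stdGaussian c
  have hε : 0 ≤ ‖c‖ * L := by positivity
  have hexp : -(‖c‖ * L) ^ 2 / (2 * ((‖c‖ ^ 2).toNNReal : ℝ)) = -L ^ 2 / 2 := by
    rw [Real.coe_toNNReal _ (by positivity)]
    field_simp
  have h1 := hsub.measure_ge_le hε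
  have h2 := hsub.neg.measure_ge_le hε
  rw [hexp] at h1 h2
  calc _ ≤ (stdGaussian E).real ({y | ‖c‖ * L ≤ inner ℝ c y} ∪
        {y | ‖c‖ * L ≤ (-fun y => inner ℝ c y) y}) := by
        refine measureReal_mono fun y hy => ?_
        have hy' : ‖c‖ * L < |inner ℝ c y| := hy
        rcases lt_abs.1 hy' with h | h
        · exact Or.inl h.le
        · exact Or.inr h.le
    _ ≤ _ := (measureReal_union_le _ _).trans (by linarith)

/-- The orthogonal projection of a standard Gaussian vector is standard Gaussian. -/
lemma map_orthogonalProjection_stdGaussian (K : Submodule ℝ E) :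
    (stdGaussian E).map K.orthogonalProjectionOnto = stdGaussian K := by
  have : IsProbabilityMeasure ((stdGaussian E).map K.orthogonalProjectionOnto) :=
    Measure.isProbabilityMeasure_map (by fun_prop)
  refine Measure.ext_of_charFun (funext fun k => ?_)
  -- For `k ∈ K`, pairing the projection of `y` with `k` is the same as pairing `y` with `k`, so
  -- both characteristic functions agree.
  have h := charFun_stdGaussian (k : E)
  rw [charFun_stdGaussian, charFun_apply, integral_map (by fun_prop) (by fun_prop)]
  rw [charFun_apply] at h
  simpa using h

lemma integrable_and_integral_exp_mul_sq_gaussianReal {θ : ℝ} (hθ : θ < 1 / 2) :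
    Integrable (fun x => Real.exp (θ * x ^ 2)) (gaussianReal 0 1) ∧
      ∫ x, Real.exp (θ * x ^ 2) ∂(gaussianReal 0 1) = √(1 / (1 - 2 * θ)) := by
  have hpdf : ∀ x : ℝ, gaussianPDFReal 0 1 x * Real.exp (θ * x ^ 2) =
      (√(2 * Real.pi))⁻¹ * Real.exp (-(1 / 2 - θ) * x ^ 2) := by
    intro x
    rw [gaussianPDFReal, mul_assoc, ← Real.exp_add]
    congr 2
    · simp
    · simp only [sub_zero, NNReal.coe_one]
      ring
  constructor
  · rw [gaussianReal_of_var_ne_zero _ one_ne_zero, integrable_withDensity_iff_integrable_smul' (by fun_prop)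
      (by simp [gaussianPDF])]
    simp only [smul_eq_mul, toReal_gaussianPDF, hpdf]
    exact (integrable_exp_neg_mul_sq (by linarith)).const_mul _
  · rw [integral_gaussianReal_eq_integral_smul one_ne_zero]
    simp only [smul_eq_mul, hpdf]
    rw [integral_const_mul, integral_gaussian, ← Real.sqrt_inv, ← Real.sqrt_mul (by positivity)]
    congr 1
    have : 1 - 2 * θ ≠ 0 := by linarith
    have : 1 / 2 - θ ≠ 0 := by linarith
    field_simp

lemma integrable_and_integral_exp_mul_norm_sq_stdGaussian {θ : ℝ} (hθ : θ < 1 / 2) :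
    Integrable (fun y : E => Real.exp (θ * ‖y‖ ^ 2)) (stdGaussian E) ∧
      ∫ y, Real.exp (θ * ‖y‖ ^ 2) ∂(stdGaussian E) =
        √(1 / (1 - 2 * θ)) ^ Module.finrank ℝ E := by
  obtain ⟨hint, heq⟩ := integrable_and_integral_exp_mul_sq_gaussianReal hθ
  let b := stdOrthonormalBasis ℝ E
  have hexp : ∀ x : Fin (Module.finrank ℝ E) → ℝ,
      Real.exp (θ * ‖∑ i, x i • b i‖ ^ 2) = ∏ i, Real.exp (θ * x i ^ 2) := by
    intro x
    have : ‖∑ i, x i • b i‖ ^ 2 = ∑ i, x i ^ 2 := by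
      have h := b.repr.symm.norm_map (WithLp.toLp 2 x)
      rw [← b.sum_repr_symm] at h
      simp only at h
      rw [h, EuclideanSpace.real_norm_sq_eq]
    rw [this, Finset.mul_sum, Real.exp_sum]
  have hmeas : Measurable fun x : Fin (Module.finrank ℝ E) → ℝ => ∑ i, x i • b i := by fun_prop
  rw [stdGaussian_eq_map_pi_orthonormalBasis b]
  constructor
  · rw [integrable_map_measure (by fun_prop) hmeas.aemeasurable]
    refine (Integrable.fintype_prod fun _ => hint).congr (ae_of_all _ fun x => ?_)
    exact (hexp x).symm
  · rw [integral_map hmeas.aemeasurable (by fun_prop)]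
    simp only [hexp]
    rw [integral_fintype_prod_eq_pow (fun x : ℝ => Real.exp (θ * x ^ 2)), heq]
    simp

/-- Upper deviation of the norm of a standard Gaussian vector. -/
lemma stdGaussian_norm_tail {s : ℕ} (hs : Module.finrank ℝ E ≤ s) {x : ℝ} (hx : 0 < x) :
    (stdGaussian E).real {y | √s + √(2 * x) < ‖y‖} ≤ Real.exp (-x) := by
  rcases Nat.eq_zero_or_pos s with rfl | hpos
  · have : Subsingleton E := Module.finrank_zero_iff (R := ℝ).1 (by omega)
    have : {y : E | √((0 : ℕ) : ℝ) + √(2 * x) < ‖y‖} = ∅ := by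
      ext y
      simp [Subsingleton.elim y 0]
    rw [this]
    simpa using (Real.exp_pos _).le
  set σ : ℝ := √s with hσ
  set r : ℝ := √(2 * x) with hr
  have hσ0 : 0 < σ := Real.sqrt_pos.2 (by exact_mod_cast hpos)
  have hr0 : 0 < r := Real.sqrt_pos.2 (by positivity)
  have hr2 : r ^ 2 = 2 * x := Real.sq_sqrt (by positivity)
  have hσ2 : σ ^ 2 = s := Real.sq_sqrt (by positivity)
  -- With this exponent `1/(1 - 2θ) = 1 + r/σ`. Bounding `√(1 + u) ≤ exp(u/2)` then bounds the
  -- moment generating function by `exp(σr/2)`, and the Chernoff exponent becomes `-r(σ + r)/2 +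
  -- σr/2 = -r²/2 = -x`.
  set θ : ℝ := r / (2 * (σ + r)) with hθ
  have hθ2 : 1 / (1 - 2 * θ) = 1 + r / σ := by
    rw [hθ]
    have : σ + r ≠ 0 := by positivity
    field_simp
    ring_nf
    field_simp
  have hθlt : θ < 1 / 2 := by
    rw [hθ, div_lt_div_iff₀ (by positivity) (by norm_num)]
    linarith
  obtain ⟨hint, heq⟩ := integrable_and_integral_exp_mul_norm_sq_stdGaussian (E := E) hθlt
  have hch := measure_ge_le_exp_mul_mgf (X := fun y : E => ‖y‖ ^ 2) (μ := stdGaussian E)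
    ((σ + r) ^ 2) (t := θ) (by positivity) hint
  rw [mgf, heq, hθ2] at hch
  have hroot : √(1 + r / σ) ≤ Real.exp (r / σ / 2) := by
    rw [Real.sqrt_le_left (Real.exp_pos _).le, ← Real.exp_nat_mul]
    convert Real.add_one_le_exp (r / σ) using 1
    · ring
    · push_cast; congr 1; ring
  have hpow : √(1 + r / σ) ^ Module.finrank ℝ E ≤ Real.exp (σ * r / 2) := by
    calc _ ≤ √(1 + r / σ) ^ s :=
          pow_le_pow_right₀ (Real.one_le_sqrt.2 (by have := div_pos hr0 hσ0; linarith)) hs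
      _ ≤ Real.exp (r / σ / 2) ^ s := by gcongr
      _ = _ := by
          rw [← Real.exp_nat_mul, ← hσ2]
          congr 1
          field_simp
  calc _ ≤ (stdGaussian E).real {y | (σ + r) ^ 2 ≤ ‖y‖ ^ 2} := by
        refine measureReal_mono fun y hy => ?_
        have hy' : σ + r < ‖y‖ := hy
        exact pow_le_pow_left₀ (by positivity) hy'.le 2
    _ ≤ Real.exp (-θ * (σ + r) ^ 2) * Real.exp (σ * r / 2) := hch.trans (by gcongr)
    _ = Real.exp (-x) := by
        rw [← Real.exp_add]
        congr 1
        have : θ * (σ + r) ^ 2 = r * (σ + r) / 2 := by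
          rw [hθ]
          field_simp
        linear_combination -this - hr2 / 2

lemma stdGaussian_starProjection_tail (K : Submodule ℝ E) {s : ℕ} (hs : Module.finrank ℝ K ≤ s)
    {x : ℝ} (hx : 0 < x) :
    (stdGaussian E).real {y | √s + √(2 * x) < ‖K.starProjection y‖} ≤ Real.exp (-x) := by
  have h := stdGaussian_norm_tail hs hx
  rw [← map_orthogonalProjection_stdGaussian, map_measureReal_apply (by fun_prop)
    (measurableSet_lt (by fun_prop) (by fun_prop))] at h
  exact h

end Gaussian

/-! ### The noise vector and its high-probability event. -/

variable {Ω : Type*} [MeasurableSpace Ω] {P : Measure Ω} [IsProbabilityMeasure P] {n p : ℕ}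

lemma hasLaw_noise {ε : Fin n → Ω → ℝ} (hlaw : ∀ i, HasLaw (ε i) (gaussianReal 0 1) P)
    (hind : iIndepFun ε P) :
    HasLaw (fun ω => WithLp.toLp 2 fun i => ε i ω) (stdGaussian (EuclideanSpace ℝ (Fin n))) P where
  aemeasurable := by
    have : ∀ i, AEMeasurable (ε i) P := fun i => (hlaw i).aemeasurable
    exact (WithLp.measurable_toLp 2 _).comp_aemeasurable (aemeasurable_pi_lambda _ this)
  map_eq := by
    have hm : ∀ i, AEMeasurable (ε i) P := fun i => (hlaw i).aemeasurable
    have h := (iIndepFun_iff_map_fun_eq_pi_map hm).1 hind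
    simp only [(hlaw _).map_eq] at h
    rw [← map_pi_eq_stdGaussian, ← h, AEMeasurable.map_map_of_aemeasurable (by fun_prop)
      (aemeasurable_pi_lambda _ hm)]
    rfl

lemma noiseLevel_sq (hp : 0 < p) {t : ℝ} (ht : 0 < t) :
    noiseLevel p t ^ 2 = 2 * (Real.log (2 * p) + t) := by
  have : (1 : ℝ) ≤ p := by exact_mod_cast hp
  have := Real.log_nonneg (by linarith : (1 : ℝ) ≤ 2 * p)
  exact Real.sq_sqrt (by linarith)

/-- With high probability, `p` linear functionals and one projection of the noise are controlled. -/
lemma exists_noise_event {ε : Fin n → Ω → ℝ} (hlaw : ∀ i, HasLaw (ε i) (gaussianReal 0 1) P)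
    (hind : iIndepFun ε P) (c : Fin p → EuclideanSpace ℝ (Fin n))
    (K : Submodule ℝ (EuclideanSpace ℝ (Fin n))) {s : ℕ} (hs : Module.finrank ℝ K ≤ s)
    {t x : ℝ} (ht : 0 < t) (hx : 0 < x) :
    ∃ T : Set Ω, MeasurableSet T ∧ 1 - Real.exp (-t) - Real.exp (-x) ≤ P.real T ∧
      ∀ ω ∈ T, (∀ j, |inner ℝ (c j) (WithLp.toLp 2 fun i => ε i ω)| ≤ ‖c j‖ * noiseLevel p t) ∧
        ‖K.starProjection (WithLp.toLp 2 fun i => ε i ω)‖ ≤ √s + √(2 * x) := by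
  set γ := stdGaussian (EuclideanSpace ℝ (Fin n))
  have hZ := hasLaw_noise hlaw hind
  set A : Fin p → Set (EuclideanSpace ℝ (Fin n)) :=
    fun j => {y | ‖c j‖ * noiseLevel p t < |inner ℝ (c j) y|} with hA
  set B : Set (EuclideanSpace ℝ (Fin n)) := {y | √s + √(2 * x) < ‖K.starProjection y‖} with hB
  have hAm : ∀ j, MeasurableSet (A j) := fun j => measurableSet_lt (by fun_prop) (by fun_prop)
  have hBm : MeasurableSet B := measurableSet_lt (by fun_prop) (by fun_prop)
  have hm : MeasurableSet ((⋃ j, A j) ∪ B) := (MeasurableSet.iUnion hAm).union hBm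
  have hAle : γ.real (⋃ j, A j) ≤ Real.exp (-t) := by
    refine (measureReal_iUnion_fintype_le A).trans ?_
    rcases Nat.eq_zero_or_pos p with rfl | hp
    · simpa using (Real.exp_pos _).le
    have hp' : (0 : ℝ) < p := by exact_mod_cast hp
    calc ∑ j, γ.real (A j) ≤ ∑ _j : Fin p, 2 * Real.exp (-noiseLevel p t ^ 2 / 2) :=
          Finset.sum_le_sum fun j _ => stdGaussian_abs_inner_tail (c j) (Real.sqrt_nonneg _)
      _ = Real.exp (-t) := by
          rw [noiseLevel_sq hp ht, show -(2 * (Real.log (2 * p) + t)) / 2 =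
            -Real.log (2 * p) + -t by ring, Real.exp_add, Real.exp_neg (Real.log _),
            Real.exp_log (by positivity)]
          simp
          field_simp
  have hle : γ.real ((⋃ j, A j) ∪ B) ≤ Real.exp (-t) + Real.exp (-x) :=
    (measureReal_union_le _ _).trans (add_le_add hAle (stdGaussian_starProjection_tail K hs hx))
  have hprob : 1 - Real.exp (-t) - Real.exp (-x) ≤ γ.real ((⋃ j, A j) ∪ B)ᶜ := by
    rw [probReal_compl_eq_one_sub hm]
    linarith
  have hnull : NullMeasurableSet
      ((fun ω => WithLp.toLp 2 fun i => ε i ω) ⁻¹' ((⋃ j, A j) ∪ B)ᶜ) P :=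
    hZ.aemeasurable.nullMeasurable hm.compl
  -- The noise is only a.e. measurable, so the good event is null-measurable; a measurable subset of
  -- equal probability replaces it.
  obtain ⟨T, hTsub, hT, hTeq⟩ := hnull.exists_measurable_subset_ae_eq
  refine ⟨T, hT, ?_, fun ω hω => ?_⟩
  · rw [measureReal_congr hTeq, ← map_measureReal_apply_of_aemeasurable hZ.aemeasurable hm.compl,
      hZ.map_eq]
    exact hprob
  · have h := hTsub hω
    simp only [Set.mem_preimage, Set.mem_compl_iff, Set.mem_union, Set.mem_iUnion, not_or,
      not_exists, hA, hB, Set.mem_ofPred_eq, not_lt] at h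
    exact h

/-! ### Deterministic analysis: first-order conditions and the upper bound. -/

section Deterministic

variable {n p : ℕ}

/-- The linear map `b ↦ X b` with values in Euclidean space. -/
noncomputable def euclideanMulVec (X : Matrix (Fin n) (Fin p) ℝ) :
    (Fin p → ℝ) →ₗ[ℝ] EuclideanSpace ℝ (Fin n) :=
  (WithLp.linearEquiv 2 ℝ (Fin n → ℝ)).symm.toLinearMap ∘ₗ X.mulVecLin

lemma l2norm_mulVec (X : Matrix (Fin n) (Fin p) ℝ) (b : Fin p → ℝ) :
    l2norm (X *ᵥ b) = ‖euclideanMulVec X b‖ := rfl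

lemma euclideanMulVec_eq_sum (X : Matrix (Fin n) (Fin p) ℝ) (b : Fin p → ℝ) :
    euclideanMulVec X b = ∑ j, b j • colVec X j := by
  ext i
  simp [euclideanMulVec, colVec, Matrix.mulVec, dotProduct, mul_comm]

lemma inner_euclideanMulVec (X : Matrix (Fin n) (Fin p) ℝ) (y : EuclideanSpace ℝ (Fin n))
    (b : Fin p → ℝ) :
    inner ℝ y (euclideanMulVec X b) = ∑ j, inner ℝ y (colVec X j) * b j := by
  simp [euclideanMulVec_eq_sum, inner_sum, inner_smul_right, mul_comm]

lemma sum_eq_sum_add_sum_notMem (S : Finset (Fin p)) (f : Fin p → ℝ) :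
    ∑ j, f j = ∑ j ∈ S, f j + ∑ j : {j // j ∉ S}, f j := by
  rw [← Finset.sum_add_sum_compl S f]
  congr 1
  exact Finset.sum_subtype _ (fun j => by simp) f

/-- The limit `τ → 0` that turns minimality along a ray, after division by `τ`, into a first-order
inequality. -/
lemma le_of_forall_le_add_mul {a b c δ : ℝ} (hδ : 0 < δ)
    (h : ∀ τ, 0 < τ → τ ≤ δ → a ≤ b + τ * c) : a ≤ b := by
  by_contra! hlt
  have hc : 0 < |c| + 1 := by positivity
  set τ := min δ ((a - b) / 2 / (|c| + 1)) with hτ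
  have hτ0 : 0 < τ := lt_min hδ (div_pos (by linarith) hc)
  have h1 := h τ hτ0 (min_le_left _ _)
  have h2 : τ * (|c| + 1) ≤ (a - b) / 2 := (le_div_iff₀ hc).1 (min_le_right _ _)
  have h3 : τ * c ≤ τ * (|c| + 1) :=
    mul_le_mul_of_nonneg_left (by linarith [le_abs_self c]) hτ0.le
  linarith

/-! ### Lasso estimators -/

/-- The penalty alone makes the criterion coercive, whatever the rank of `X`. -/
lemma exists_isLasso (X : Matrix (Fin n) (Fin p) ℝ) (y : Fin n → ℝ) {lam : ℝ} (hlam : 0 < lam) :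
    ∃ b, IsLasso X y lam b := by
  have hcont : Continuous (lassoObjective X y lam) := by
    unfold lassoObjective l2norm
    have : Continuous fun b : Fin p → ℝ => y - X *ᵥ b := by fun_prop
    fun_prop
  have hlim : Filter.Tendsto (lassoObjective X y lam) (Filter.cocompact _) Filter.atTop := by
    refine Filter.tendsto_atTop_mono (f := fun b => (2 * lam) * ‖b‖) (fun b => ?_)
      (Filter.Tendsto.const_mul_atTop (by positivity) (tendsto_norm_cocompact_atTop))
    have h1 : ‖b‖ ≤ ∑ j, |b j| := by
      refine (pi_norm_le_iff_of_nonneg (Finset.sum_nonneg fun _ _ => abs_nonneg _)).2 fun j => ?_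
      exact Finset.single_le_sum (f := fun j => |b j|) (fun _ _ => abs_nonneg _)
        (Finset.mem_univ j)
    have h2 := mul_le_mul_of_nonneg_left h1 (by positivity : 0 ≤ 2 * lam)
    have h3 := sq_nonneg (l2norm (y - X *ᵥ b))
    unfold lassoObjective
    linarith
  obtain ⟨b, hb⟩ := hcont.exists_forall_le hlim
  exact ⟨b, fun g _ => hb g⟩

/-- Compare `b` with `b` moved by `τ s` in coordinate `j`. Convexity bounds the change in penalty
linearly in `τ`, and the quadratic remainder vanishes as `τ → 0`. -/
lemma IsLasso.inner_colVec_mul_le {X : Matrix (Fin n) (Fin p) ℝ} {y : Fin n → ℝ} {lam : ℝ}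
    (hlam : 0 < lam) {b : Fin p → ℝ} (hb : IsLasso X y lam b) (j : Fin p) (s : ℝ) :
    inner ℝ (WithLp.toLp 2 y - euclideanMulVec X b) (colVec X j) * s ≤
      lam * (|b j + s| - |b j|) := by
  set r := WithLp.toLp 2 y - euclideanMulVec X b with hr
  refine le_of_forall_le_add_mul (c := ‖s • colVec X j‖ ^ 2 / 2) one_pos fun τ hτ hτ1 => ?_
  set g : Fin p → ℝ := Pi.single j (τ * s) with hg
  have hmin : lassoObjective X y lam b ≤ lassoObjective X y lam (b + g) := hb (Set.mem_univ _)
  have hΦg : euclideanMulVec X g = τ • s • colVec X j := by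
    rw [euclideanMulVec_eq_sum, Finset.sum_eq_single j]
    · simp [hg, smul_smul]
    · intro k _ hk
      simp [hg, hk]
    · simp
  have hres : l2norm (y - X *ᵥ (b + g)) = ‖r - τ • s • colVec X j‖ := by
    rw [← hΦg, hr, sub_sub, ← map_add]
    rfl
  have hres0 : l2norm (y - X *ᵥ b) = ‖r‖ := rfl
  have hsum : ∑ k, |(b + g) k| - ∑ k, |b k| = |b j + τ * s| - |b j| := by
    rw [← Finset.sum_sub_distrib, Finset.sum_eq_single j]
    · simp [hg]
    · intro k _ hk
      simp [hg, hk]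
    · simp
  have hconv : |b j + τ * s| ≤ (1 - τ) * |b j| + τ * |b j + s| := by
    calc |b j + τ * s| = |(1 - τ) * b j + τ * (b j + s)| := by ring_nf
      _ ≤ |(1 - τ) * b j| + |τ * (b j + s)| := abs_add_le _ _
      _ = _ := by rw [abs_mul, abs_mul, abs_of_nonneg (by linarith), abs_of_pos hτ]
  unfold lassoObjective at hmin
  rw [hres, hres0, norm_sub_sq_real r (τ • s • colVec X j), inner_smul_right, inner_smul_right, norm_smul,
    Real.norm_of_nonneg hτ.le, mul_pow] at hmin
  have h1 := mul_le_mul_of_nonneg_left hconv hlam.le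
  have h2 : 0 ≤ τ * (lam * (|b j + s| - |b j|) + τ * (‖s • colVec X j‖ ^ 2 / 2) -
      inner ℝ r (colVec X j) * s) := by
    have : lam * ∑ k, |(b + g) k| - lam * ∑ k, |b k| = lam * (|b j + τ * s| - |b j|) := by
      rw [← mul_sub, hsum]
    nlinarith
  have h3 := nonneg_of_mul_nonneg_right h2 hτ
  linarith

/-- A Lasso estimator satisfies the first order conditions, coordinatewise. -/
lemma IsLasso.exists_subgradient {X : Matrix (Fin n) (Fin p) ℝ} {y : Fin n → ℝ} {lam : ℝ}
    (hlam : 0 < lam) {b : Fin p → ℝ} (hb : IsLasso X y lam b) :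
    ∃ ζ : Fin p → ℝ, (∀ j, |ζ j| ≤ 1) ∧ (∀ j, ζ j * b j = |b j|) ∧
      ∀ j, inner ℝ (WithLp.toLp 2 y - euclideanMulVec X b) (colVec X j) = lam * ζ j := by
  set r := WithLp.toLp 2 y - euclideanMulVec X b with hr
  have h := hb.inner_colVec_mul_le hlam
  -- The moves `s = ±1` bound the subgradient; `s = -b j`, which kills the coordinate, gives
  -- alignment with `b j` below.
  have hle : ∀ j, |inner ℝ r (colVec X j) / lam| ≤ 1 := by
    intro j
    have h1 := h j 1
    have h2 := h j (-1)
    have h3 : |b j + 1| - |b j| ≤ 1 := by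
      have := abs_add_le (b j) 1
      rw [abs_one] at this
      linarith
    have h4 : |b j + -1| - |b j| ≤ 1 := by
      have := abs_add_le (b j) (-1)
      rw [abs_neg, abs_one] at this
      linarith
    rw [abs_div, abs_of_pos hlam, div_le_one hlam, abs_le]
    constructor <;> nlinarith
  refine ⟨fun j => inner ℝ r (colVec X j) / lam, hle, fun j => ?_, fun j => ?_⟩
  · refine le_antisymm ?_ ?_
    · refine (le_abs_self _).trans ?_
      rw [abs_mul]
      exact mul_le_of_le_one_left (abs_nonneg _) (hle j)
    · have h1 := h j (-b j)
      simp only [add_neg_cancel, abs_zero, zero_sub, ← hr] at h1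
      rw [div_mul_eq_mul_div, le_div_iff₀ hlam]
      linarith
  · field_simp

lemma isKKT_of_subgradient {X : Matrix (Fin n) (Fin p) ℝ} {y : Fin n → ℝ} {lam : ℝ}
    {b ζ : Fin p → ℝ} (h1 : ∀ j, |ζ j| ≤ 1) (h2 : ∀ j, ζ j * b j = |b j|)
    (h3 : ∀ j, inner ℝ (WithLp.toLp 2 y - euclideanMulVec X b) (colVec X j) = lam * ζ j) :
    IsKKT X y lam b := by
  refine ⟨ζ, h1, Finset.sum_congr rfl fun j _ => h2 j, funext fun j => ?_⟩
  rw [Pi.smul_apply, smul_eq_mul, ← h3 j]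
  simp [Matrix.mulVec, dotProduct, colVec, euclideanMulVec, PiLp.inner_apply]

/-! ### Splitting the noise along the active columns -/

lemma inner_sub_starProjection_colVec_of_mem (X : Matrix (Fin n) (Fin p) ℝ)
    (S : Finset (Fin p)) (e : EuclideanSpace ℝ (Fin n)) {j : Fin p} (hj : j ∈ S) :
    inner ℝ (e - (colSpan X S).starProjection e) (colVec X j) = 0 :=
  (colSpan X S).starProjection_inner_eq_zero e _
    (Submodule.subset_span (Set.mem_image_of_mem _ hj))

lemma inner_sub_starProjection_euclideanMulVec (X : Matrix (Fin n) (Fin p) ℝ)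
    (S : Finset (Fin p)) (e : EuclideanSpace ℝ (Fin n)) (g : Fin p → ℝ) :
    inner ℝ (e - (colSpan X S).starProjection e) (euclideanMulVec X g) =
      ∑ j : {j // j ∉ S},
        inner ℝ (e - (colSpan X S).starProjection e) (colVec X j) * g j := by
  rw [inner_euclideanMulVec, sum_eq_sum_add_sum_notMem S, Finset.sum_eq_zero, zero_add]
  intro j hj
  rw [inner_sub_starProjection_colVec_of_mem X S e hj, zero_mul]

/-- Self-adjointness of the projection: it converts functionals of `e` given by residual columns
into correlations of the residual noise. -/
lemma inner_sub_starProjection_comm (X : Matrix (Fin n) (Fin p) ℝ)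
    (S : Finset (Fin p)) (e f : EuclideanSpace ℝ (Fin n)) :
    inner ℝ (e - (colSpan X S).starProjection e) f =
      inner ℝ (f - (colSpan X S).starProjection f) e := by
  rw [inner_sub_left, inner_sub_left, Submodule.inner_starProjection_left_eq_right,
    real_inner_comm, real_inner_comm e ((colSpan X S).starProjection f)]

lemma finrank_colSpan_le (X : Matrix (Fin n) (Fin p) ℝ) (S : Finset (Fin p)) :
    Module.finrank ℝ (colSpan X S) ≤ S.card := by
  classical
  have h := finrank_span_finset_le_card (R := ℝ) (S.image (colVec X))
  rw [Finset.coe_image] at h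
  exact h.trans Finset.card_image_le

/-! ### The upper bound -/

lemma eq_zero_of_notMem_activeSet {β : Fin p → ℝ} {j : Fin p} (hj : j ∉ activeSet β) :
    β j = 0 := by
  simpa [activeSet] using hj

lemma weightedOff_of_nonneg {S : Finset (Fin p)} {w : {j // j ∉ S} → ℝ} (hw : ∀ j, 0 ≤ w j)
    (b : Fin p → ℝ) : weightedOff S w b = ∑ j : {j // j ∉ S}, w j * |b j| :=
  Finset.sum_congr rfl fun j _ => by rw [abs_mul, abs_of_nonneg (hw j)]

lemma weightedOff_smul {S : Finset (Fin p)} (w : {j // j ∉ S} → ℝ) {c : ℝ} (hc : 0 ≤ c)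
    (b : Fin p → ℝ) : weightedOff S w (c • b) = c * weightedOff S w b := by
  rw [weightedOff, weightedOff, Finset.mul_sum]
  refine Finset.sum_congr rfl fun j _ => ?_
  rw [Pi.smul_apply, smul_eq_mul, mul_left_comm, abs_mul, abs_of_nonneg hc]

lemma weightedOff_add_le {S : Finset (Fin p)} (w : {j // j ∉ S} → ℝ) (b g : Fin p → ℝ) :
    weightedOff S w (b + g) ≤ weightedOff S w b + weightedOff S w g := by
  rw [weightedOff, weightedOff, weightedOff, ← Finset.sum_add_distrib]
  refine Finset.sum_le_sum fun j _ => ?_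
  rw [Pi.add_apply, mul_add]
  exact abs_add_le _ _

/-- Off `S` the error equals `b`, so the subgradient contributes exactly `|d j|`, of which the noise
can cancel at most the fraction `v j`. On `S` only `|ζ j| ≤ 1` is used. -/
lemma IsLasso.basic_inequality {X : Matrix (Fin n) (Fin p) ℝ} {S : Finset (Fin p)}
    {β0 : Fin p → ℝ} (hS : ∀ j, j ∉ S → β0 j = 0) {lam : ℝ} (hlam : 0 < lam)
    {e : EuclideanSpace ℝ (Fin n)} {v : {j // j ∉ S} → ℝ} (hv : ∀ j, v j ≤ 1)
    (hη : ∀ j : {j // j ∉ S},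
      |inner ℝ (e - (colSpan X S).starProjection e) (colVec X j)| ≤ lam * v j)
    {y : Fin n → ℝ} (hy : WithLp.toLp 2 y = euclideanMulVec X β0 + e)
    {b : Fin p → ℝ} (hb : IsLasso X y lam b) :
    ‖euclideanMulVec X (b - β0)‖ ^ 2 ≤
      ‖(colSpan X S).starProjection e‖ * ‖euclideanMulVec X (b - β0)‖ +
        lam * (∑ j ∈ S, |(b - β0) j| - weightedOff S (1 - v) (b - β0)) := by
  obtain ⟨ζ, hζ1, hζ2, hζ3⟩ := hb.exists_subgradient hlam
  set d := b - β0 with hd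
  set u := (colSpan X S).starProjection e with hu
  have hres : WithLp.toLp 2 y - euclideanMulVec X b = (e - u) + u - euclideanMulVec X d := by
    rw [hy, hd, map_sub]
    abel
  have hkey : inner ℝ (WithLp.toLp 2 y - euclideanMulVec X b) (euclideanMulVec X d) =
      lam * ∑ j, ζ j * d j := by
    rw [inner_euclideanMulVec, Finset.mul_sum]
    exact Finset.sum_congr rfl fun j _ => by rw [hζ3, mul_assoc]
  rw [hres, inner_sub_left, inner_add_left, inner_sub_starProjection_euclideanMulVec,
    real_inner_self_eq_norm_sq, sum_eq_sum_add_sum_notMem S] at hkey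
  have hS' : -∑ j ∈ S, ζ j * d j ≤ ∑ j ∈ S, |d j| := by
    rw [← Finset.sum_neg_distrib]
    refine Finset.sum_le_sum fun j _ => ?_
    calc -(ζ j * d j) ≤ |ζ j * d j| := neg_le_abs _
      _ = |ζ j| * |d j| := abs_mul _ _
      _ ≤ |d j| := mul_le_of_le_one_left (abs_nonneg _) (hζ1 j)
  have hoff : ∑ j : {j // j ∉ S}, inner ℝ (e - u) (colVec X j) * d j -
      lam * ∑ j : {j // j ∉ S}, ζ j * d j ≤ -(lam * weightedOff S (1 - v) d) := by
    rw [weightedOff_of_nonneg (fun j => by simpa using hv j), Finset.mul_sum, Finset.mul_sum,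
      ← Finset.sum_sub_distrib, ← Finset.sum_neg_distrib]
    refine Finset.sum_le_sum fun j _ => ?_
    have hdj : d j = b j := by rw [hd, Pi.sub_apply, hS j j.2, sub_zero]
    have h1 : inner ℝ (e - u) (colVec X j) * d j ≤ lam * v j * |d j| :=
      (le_abs_self _).trans (by
        rw [abs_mul]
        exact mul_le_mul_of_nonneg_right (hη j) (abs_nonneg _))
    have h2 : ζ j * d j = |d j| := by rw [hdj, hζ2]
    rw [h2, Pi.sub_apply, Pi.one_apply]
    linarith
  have hcs : inner ℝ u (euclideanMulVec X d) ≤ ‖u‖ * ‖euclideanMulVec X d‖ :=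
    real_inner_le_norm _ _
  have hS'' := mul_le_mul_of_nonneg_left hS' hlam.le
  linarith

/-- Rescaling `d` to constraint value one makes it a competitor in the infimum defining `kappaSq`.
Positivity of that value already forces `S` to be nonempty. -/
lemma le_rate_of_compat (hn : 0 < n) {X : Matrix (Fin n) (Fin p) ℝ} {S : Finset (Fin p)}
    {w : {j // j ∉ S} → ℝ} {lam : ℝ} (hlam : 0 < lam) {d : Fin p → ℝ} {N : ℝ}
    (hm : 0 < ∑ j ∈ S, |d j| - weightedOff S w d) (hN : ‖euclideanMulVec X d‖ ≠ 0)
    (hNle : N ≤ lam * (∑ j ∈ S, |d j| - weightedOff S w d) / ‖euclideanMulVec X d‖) :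
    ENNReal.ofReal N ≤ rate X S w lam := by
  set m := ∑ j ∈ S, |d j| - weightedOff S w d with hm'
  have hNpos : 0 < ‖euclideanMulVec X d‖ := lt_of_le_of_ne (norm_nonneg _) hN.symm
  have hn' : (0 : ℝ) < n := by exact_mod_cast hn
  have hScard : 0 < S.card := by
    rcases S.eq_empty_or_nonempty with rfl | h
    · have : 0 ≤ weightedOff ∅ w d := Finset.sum_nonneg fun _ _ => abs_nonneg _
      simp at hm'
      linarith
    · exact h.card_pos
  have hs' : (0 : ℝ) < S.card := by exact_mod_cast hScard
  have hmem : m⁻¹ • d ∈ compatSet S w := by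
    change ∑ j ∈ S, |(m⁻¹ • d) j| - weightedOff S w (m⁻¹ • d) = 1
    have h1 : ∑ j ∈ S, |(m⁻¹ • d) j| = m⁻¹ * ∑ j ∈ S, |d j| := by
      rw [Finset.mul_sum]
      refine Finset.sum_congr rfl fun j _ => ?_
      rw [Pi.smul_apply, smul_eq_mul, abs_mul, abs_of_pos (inv_pos.2 hm)]
    rw [h1, weightedOff_smul w (inv_pos.2 hm).le, ← mul_sub, ← hm', inv_mul_cancel₀ hm.ne']
  have hkappa : kappaSq X S w ≤
      ENNReal.ofReal (S.card * (‖euclideanMulVec X d‖ / m) ^ 2 / n) := by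
    refine (iInf₂_le _ hmem).trans (le_of_eq ?_)
    rw [l2norm_mulVec, map_smul, norm_smul, Real.norm_of_nonneg (inv_pos.2 hm).le,
      div_eq_inv_mul ‖euclideanMulVec X d‖]
  have hdiv : ENNReal.ofReal (n * (m / ‖euclideanMulVec X d‖) ^ 2) ≤
      (S.card : ℝ≥0∞) / kappaSq X S w := by
    refine le_trans (le_of_eq ?_) (ENNReal.div_le_div_left hkappa _)
    rw [← ENNReal.ofReal_natCast S.card, ← ENNReal.ofReal_div_of_pos (by positivity)]
    congr 1
    field_simp
  calc ENNReal.ofReal N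
      ≤ ENNReal.ofReal (√(n * (m / ‖euclideanMulVec X d‖) ^ 2)) *
        ENNReal.ofReal √(lam ^ 2 / n) := by
        rw [← ENNReal.ofReal_mul (Real.sqrt_nonneg _), ← Real.sqrt_mul (by positivity)]
        refine ENNReal.ofReal_le_ofReal (hNle.trans (le_of_eq ?_))
        symm
        rw [Real.sqrt_eq_iff_mul_self_eq (by positivity) (by positivity)]
        field_simp
    _ ≤ rate X S w lam := by
        unfold rate
        gcongr
        rw [Real.sqrt_eq_rpow, ← ENNReal.ofReal_rpow_of_nonneg (by positivity) (by norm_num)]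
        gcongr

/-- Deterministic upper bound for the prediction error. -/
lemma IsLasso.upper_bound (hn : 0 < n) {X : Matrix (Fin n) (Fin p) ℝ} {S : Finset (Fin p)}
    {β0 : Fin p → ℝ} (hS : ∀ j, j ∉ S → β0 j = 0) {lam : ℝ} (hlam : 0 < lam)
    {e : EuclideanSpace ℝ (Fin n)} {v : {j // j ∉ S} → ℝ} (hv : ∀ j, v j ≤ 1)
    (hη : ∀ j : {j // j ∉ S},
      |inner ℝ (e - (colSpan X S).starProjection e) (colVec X j)| ≤ lam * v j)
    {y : Fin n → ℝ} (hy : WithLp.toLp 2 y = euclideanMulVec X β0 + e)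
    {b : Fin p → ℝ} (hb : IsLasso X y lam b) :
    ((l2norm (X *ᵥ (b - β0)) : ℝ) : EReal) ≤
      (rate X S (1 - v) lam : EReal) + (‖(colSpan X S).starProjection e‖ : ℝ) := by
  have h := hb.basic_inequality hS hlam hv hη hy
  rw [l2norm_mulVec]
  set N := ‖euclideanMulVec X (b - β0)‖ with hN
  set R := ‖(colSpan X S).starProjection e‖ with hR
  have hR0 : 0 ≤ R := norm_nonneg _
  have hsuff : ENNReal.ofReal (N - R) ≤ rate X S (1 - v) lam := by
    -- If `N ≤ R` the truncated left side is zero; otherwise `N > 0` and the basic inequality can be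
    -- divided by `N`.
    rcases le_or_gt N R with hle | hlt
    · rw [ENNReal.ofReal_of_nonpos (by linarith)]
      exact zero_le
    have hN0 : 0 < N := by linarith
    have h' : N * (N - R) ≤
        lam * (∑ j ∈ S, |(b - β0) j| - weightedOff S (1 - v) (b - β0)) := by nlinarith
    have hm : 0 < ∑ j ∈ S, |(b - β0) j| - weightedOff S (1 - v) (b - β0) := by
      have : 0 < N * (N - R) := mul_pos hN0 (by linarith)
      exact pos_of_mul_pos_right (this.trans_le h') hlam.le
    refine le_rate_of_compat hn hlam hm hN0.ne' ?_
    rw [le_div_iff₀ hN0]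
    linarith
  calc ((N : ℝ) : EReal) = ((N - R : ℝ) : EReal) + (R : ℝ) := by
        rw [← EReal.coe_add, sub_add_cancel]
    _ ≤ _ := by
        gcongr
        refine le_trans ?_ (EReal.coe_ennreal_le_coe_ennreal_iff.2 hsuff)
        rw [EReal.coe_ennreal_ofReal]
        exact_mod_cast le_max_left _ _

end Deterministic

/-! ### The sign-constrained problem and the exact error formula. -/

section LowerBound

variable {n p : ℕ}

/-! ### Minimizers over the signed constraint set -/

/-- First-order condition in an arbitrary direction `g`: the constraint functional is concave and
positively homogeneous, so `b + τ • g` becomes feasible once divided by `1 + τ q`. -/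
lemma IsSignedMinimizer.mul_le_inner {X : Matrix (Fin n) (Fin p) ℝ} {S : Finset (Fin p)}
    {z : Fin p → ℝ} {w : {j // j ∉ S} → ℝ} {b : Fin p → ℝ} (hb : IsSignedMinimizer X S z w b)
    (g : Fin p → ℝ) :
    ‖euclideanMulVec X b‖ ^ 2 * (∑ j ∈ S, z j * g j - weightedOff S w g) ≤
      inner ℝ (euclideanMulVec X b) (euclideanMulVec X g) := by
  set μ := ‖euclideanMulVec X b‖ ^ 2 with hμ
  set q := ∑ j ∈ S, z j * g j - weightedOff S w g with hq
  -- This range of `τ` keeps the normalizing factor `1 + τ q` positive.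
  refine le_of_forall_le_add_mul (δ := 1 / (1 + |q|)) (c := ‖euclideanMulVec X g‖ ^ 2 / 2)
    (by positivity) fun τ hτ hτδ => ?_
  have hpos : 0 < 1 + τ * q := by
    have h1 : τ * (1 + |q|) ≤ 1 := (le_div_iff₀ (by positivity)).1 hτδ
    have h2 : τ * -|q| ≤ τ * q := mul_le_mul_of_nonneg_left (neg_abs_le q) hτ.le
    linarith
  have hmem : (1 + τ * q)⁻¹ • (b + τ • g) ∈ signedSet S z w := by
    change 1 ≤ ∑ j ∈ S, z j * ((1 + τ * q)⁻¹ • (b + τ • g)) j -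
      weightedOff S w ((1 + τ * q)⁻¹ • (b + τ • g))
    have h1 : ∑ j ∈ S, z j * ((1 + τ * q)⁻¹ • (b + τ • g)) j =
        (1 + τ * q)⁻¹ * (∑ j ∈ S, z j * b j + τ * ∑ j ∈ S, z j * g j) := by
      rw [Finset.mul_sum, ← Finset.sum_add_distrib, Finset.mul_sum]
      refine Finset.sum_congr rfl fun j _ => ?_
      simp only [Pi.smul_apply, Pi.add_apply, smul_eq_mul]
      ring
    rw [h1, weightedOff_smul w (inv_pos.2 hpos).le, ← mul_sub, ← div_eq_inv_mul,
      le_div_iff₀ hpos]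
    have h2 := weightedOff_add_le w b (τ • g)
    rw [weightedOff_smul w hτ.le] at h2
    have h3 : 1 ≤ ∑ j ∈ S, z j * b j - weightedOff S w b := hb.1
    have h4 : τ * q = τ * ∑ j ∈ S, z j * g j - τ * weightedOff S w g := by rw [hq, mul_sub]
    linarith
  have hmin : μ ≤ ‖euclideanMulVec X ((1 + τ * q)⁻¹ • (b + τ • g))‖ ^ 2 := hb.2 hmem
  rw [map_smul, norm_smul, Real.norm_of_nonneg (inv_pos.2 hpos).le, mul_pow, inv_pow,
    ← div_eq_inv_mul, le_div_iff₀ (by positivity), map_add, map_smul, norm_add_sq_real, ← hμ,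
    inner_smul_right, norm_smul, Real.norm_of_nonneg hτ.le, mul_pow] at hmin
  have hμ0 : 0 ≤ μ := by positivity
  have h5 : 0 ≤ μ * (τ * q) ^ 2 := by positivity
  have h6 : 0 ≤ τ * (inner ℝ (euclideanMulVec X b) (euclideanMulVec X g) +
      τ * (‖euclideanMulVec X g‖ ^ 2 / 2) - μ * q) := by nlinarith
  have h7 := nonneg_of_mul_nonneg_right h6 hτ
  linarith

/-- The direction `g = b` in the variational inequality shows that the constraint is active when `X
b ≠ 0`. -/
lemma IsSignedMinimizer.constraint_eq_one {X : Matrix (Fin n) (Fin p) ℝ} {S : Finset (Fin p)}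
    {z : Fin p → ℝ} {w : {j // j ∉ S} → ℝ} {b : Fin p → ℝ} (hb : IsSignedMinimizer X S z w b)
    (hpos : 0 < ‖euclideanMulVec X b‖) :
    ∑ j ∈ S, z j * b j - weightedOff S w b = 1 := by
  have h := hb.mul_le_inner b
  rw [real_inner_self_eq_norm_sq] at h
  refine le_antisymm ?_ hb.1
  have : 0 < ‖euclideanMulVec X b‖ ^ 2 := by positivity
  exact le_of_mul_le_mul_left (by linarith) this

/-- If the signs of the coefficients are large enough to be recovered, then the prediction error of
the Lasso is determined by a minimizer over the signed constraint set, for some weights. -/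
lemma IsLasso.exists_weight_norm_eq {X : Matrix (Fin n) (Fin p) ℝ} {S : Finset (Fin p)}
    {β : Fin p → ℝ} (hβ : ∀ j, j ∉ S → β j = 0) {lam : ℝ} (hlam : 0 < lam)
    {η : EuclideanSpace ℝ (Fin n)} (hηS : ∀ j ∈ S, inner ℝ η (colVec X j) = 0)
    {v : {j // j ∉ S} → ℝ} (hv : ∀ j, v j < 1)
    (hη : ∀ j : {j // j ∉ S}, |inner ℝ η (colVec X j)| ≤ lam * v j)
    {y : Fin n → ℝ} (hy : WithLp.toLp 2 y = euclideanMulVec X β + η)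
    {z : Fin p → ℝ} (hz : ∀ j, |z j| ≤ 1) {bw : ({j // j ∉ S} → ℝ) → Fin p → ℝ}
    (hbw : ∀ w ∈ weightSet v, IsSignedMinimizer X S z w (bw w))
    (hpos : ∀ w ∈ weightSet v, 0 < ‖euclideanMulVec X (bw w)‖)
    (hsign : ∀ w ∈ weightSet v, ∀ j ∈ S,
      z j * (β j - lam / ‖euclideanMulVec X (bw w)‖ ^ 2 * bw w j) =
        |β j - lam / ‖euclideanMulVec X (bw w)‖ ^ 2 * bw w j|)
    {b : Fin p → ℝ} (hb : IsLasso X y lam b) :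
    ∃ w ∈ weightSet v, ‖euclideanMulVec X (b - β)‖ = lam / ‖euclideanMulVec X (bw w)‖ := by
  classical
  obtain ⟨ζ, hζ1, hζ2, hζ3⟩ := hb.exists_subgradient hlam
  set d := β - b with hd
  set c : {j // j ∉ S} → ℝ := fun j => inner ℝ η (colVec X j) / lam with hc
  have hcv : ∀ j, |c j| ≤ v j := fun j => by
    rw [hc, abs_div, abs_of_pos hlam, div_le_iff₀ hlam, mul_comm]
    exact hη j
  have hcζ : ∀ j : {j // j ∉ S}, |c j * ζ j| ≤ v j := fun j => by
    rw [abs_mul]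
    exact (mul_le_of_le_one_right (abs_nonneg _) (hζ1 j)).trans (hcv j)
  have hv0 : ∀ j, 0 ≤ v j := fun j => (abs_nonneg _).trans (hcv j)
  -- The weights are chosen so that `c - ζ` is dominated by `w` and attains `w j * |d j|` at the
  -- error `d`. Where `b j ≠ 0`, `ζ j` is its sign and `|c j - ζ j| = 1 - c j * ζ j`; where `b j =
  -- 0`, the largest admissible weight works.
  set w : {j // j ∉ S} → ℝ := fun j => if b j = 0 then 1 + v j else 1 - c j * ζ j with hw
  have hwmem : w ∈ weightSet v := by
    intro j
    have h1 := abs_le.1 (hcζ j)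
    have h2 := hv0 j
    simp only [hw]
    split_ifs <;> constructor <;> linarith
  have hw0 : ∀ j, 0 ≤ w j := fun j => by linarith [(hwmem j).1, hv j]
  have hdj : ∀ j : {j // j ∉ S}, d j = -b j := fun j => by
    rw [hd, Pi.sub_apply, hβ j j.2, zero_sub]
  have hρ : ∀ j : {j // j ∉ S}, |c j - ζ j| ≤ w j ∧ (c j - ζ j) * d j = w j * |d j| := by
    intro j
    by_cases h0 : b j = 0
    · have h1 : w j = 1 + v j := if_pos h0
      refine ⟨?_, by simp [hdj, h0]⟩
      rw [h1]
      linarith [abs_sub (c j) (ζ j), hcv j, hζ1 j]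
    · have h1 : w j = 1 - c j * ζ j := if_neg h0
      have h2 := hw0 j
      rw [h1] at h2
      rw [h1, hdj, abs_neg]
      have hζb := hζ2 j
      rcases lt_or_gt_of_ne h0 with hneg | hpos'
      · have h3 : ζ j = -1 := by
          rw [abs_of_neg hneg] at hζb
          exact mul_right_cancel₀ h0 (by linarith)
        rw [h3] at h2 ⊢
        rw [abs_of_neg hneg]
        refine ⟨?_, by ring⟩
        rw [abs_of_nonneg (by linarith)]
        linarith
      · have h3 : ζ j = 1 := by
          rw [abs_of_pos hpos'] at hζb
          exact mul_right_cancel₀ h0 (by linarith)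
        rw [h3] at h2 ⊢
        rw [abs_of_pos hpos']
        refine ⟨?_, by ring⟩
        rw [abs_of_nonpos (by linarith)]
        linarith
  have hkey : ∀ g : Fin p → ℝ, inner ℝ (euclideanMulVec X d) (euclideanMulVec X g) =
      lam * (∑ j ∈ S, ζ j * g j - ∑ j : {j // j ∉ S}, (c j - ζ j) * g j) := by
    intro g
    have h1 : euclideanMulVec X d = WithLp.toLp 2 y - euclideanMulVec X b - η := by
      rw [hy, hd, map_sub]
      abel
    rw [h1, inner_euclideanMulVec, sum_eq_sum_add_sum_notMem S, mul_sub, Finset.mul_sum,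
      Finset.mul_sum, sub_eq_add_neg (∑ i ∈ S, lam * (ζ i * g i)), ← Finset.sum_neg_distrib]
    congr 1
    · refine Finset.sum_congr rfl fun j hj => ?_
      rw [inner_sub_left, hζ3, hηS j hj]
      ring
    · refine Finset.sum_congr rfl fun j _ => ?_
      rw [inner_sub_left, hζ3, hc]
      field_simp
      ring
  have hmin := hbw w hwmem
  have hN := hpos w hwmem
  have hq := hmin.constraint_eq_one hN
  have hge := hmin.mul_le_inner d
  have hsg := hsign w hwmem
  set N := ‖euclideanMulVec X (bw w)‖ with hNdef
  have hr : 0 ≤ lam / N ^ 2 := by positivity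
  -- This scaling turns the factor `N ^ 2` in the variational inequality of `bw w` into `lam`,
  -- matching the first-order conditions of `d`.
  set h := (lam / N ^ 2) • bw w with hh
  have hhh : inner ℝ (euclideanMulVec X h) (euclideanMulVec X h) =
      lam * (∑ j ∈ S, z j * h j - weightedOff S w h) := by
    have h1 : ∑ j ∈ S, z j * h j = lam / N ^ 2 * ∑ j ∈ S, z j * bw w j := by
      rw [Finset.mul_sum]
      refine Finset.sum_congr rfl fun j _ => ?_
      rw [hh, Pi.smul_apply, smul_eq_mul]
      ring
    rw [h1, hh, weightedOff_smul w hr, ← mul_sub, hq, map_smul, real_inner_self_eq_norm_sq,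
      norm_smul, Real.norm_of_nonneg hr, ← hNdef]
    field_simp
  have hhd : lam * (∑ j ∈ S, z j * d j - weightedOff S w d) ≤
      inner ℝ (euclideanMulVec X h) (euclideanMulVec X d) := by
    rw [hh, map_smul, real_inner_smul_left]
    refine le_trans (le_of_eq ?_) (mul_le_mul_of_nonneg_left hge hr)
    field_simp
  have hdh : lam * (∑ j ∈ S, ζ j * h j - weightedOff S w h) ≤
      inner ℝ (euclideanMulVec X h) (euclideanMulVec X d) := by
    rw [real_inner_comm, hkey, weightedOff_of_nonneg hw0]
    refine mul_le_mul_of_nonneg_left (sub_le_sub_left (Finset.sum_le_sum fun j _ => ?_) _) hlam.le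
    refine (le_abs_self _).trans ?_
    rw [abs_mul]
    exact mul_le_mul_of_nonneg_right (hρ j).1 (abs_nonneg _)
  have hdd : inner ℝ (euclideanMulVec X d) (euclideanMulVec X d) =
      lam * (∑ j ∈ S, ζ j * d j - weightedOff S w d) := by
    rw [hkey, weightedOff_of_nonneg hw0, Finset.sum_congr rfl fun j _ => (hρ j).2]
  -- Monotonicity of the `ℓ₁` subdifferential: on `S`, `z` is a subgradient at `β - h` by `hsign`
  -- and `ζ` is one at `b`.
  have hmono : ∑ j ∈ S, z j * h j - ∑ j ∈ S, z j * d j - ∑ j ∈ S, ζ j * h j +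
      ∑ j ∈ S, ζ j * d j ≤ 0 := by
    rw [← Finset.sum_sub_distrib, ← Finset.sum_sub_distrib, ← Finset.sum_add_distrib]
    refine Finset.sum_nonpos fun j hj => ?_
    set x := β j - lam / N ^ 2 * bw w j with hx
    have h1 : h j = β j - x := by
      rw [hx, hh, Pi.smul_apply, smul_eq_mul]
      ring
    have h2 : d j = β j - b j := rfl
    have h3 : z j * x = |x| := hsg j hj
    have h4 := hζ2 j
    have h5 : z j * b j ≤ |b j| := (le_abs_self _).trans (by
      rw [abs_mul]
      exact mul_le_of_le_one_left (abs_nonneg _) (hz j))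
    have h6 : ζ j * x ≤ |x| := (le_abs_self _).trans (by
      rw [abs_mul]
      exact mul_le_of_le_one_left (abs_nonneg _) (hζ1 j))
    rw [h1, h2]
    linarith
  -- Each lower bound on the cross term is used once, so all the weighted off-support terms cancel.
  have hfin : ‖euclideanMulVec X h - euclideanMulVec X d‖ ^ 2 ≤ 0 := by
    rw [norm_sub_sq_real, ← real_inner_self_eq_norm_sq, ← real_inner_self_eq_norm_sq, hhh, hdd]
    have := mul_nonpos_of_nonneg_of_nonpos hlam.le hmono
    linarith
  have heq : euclideanMulVec X h = euclideanMulVec X d := by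
    have h1 : ‖euclideanMulVec X h - euclideanMulVec X d‖ = 0 :=
      pow_eq_zero_iff two_ne_zero |>.1 (le_antisymm hfin (sq_nonneg _))
    exact sub_eq_zero.1 (norm_eq_zero.1 h1)
  refine ⟨w, hwmem, ?_⟩
  rw [← neg_sub β b, map_neg, norm_neg, ← hd, ← heq, hh, map_smul, norm_smul,
    Real.norm_of_nonneg hr, ← hNdef]
  field_simp

/-! ### The Gram matrix of the active columns -/

/-- A kernel vector of the Gram matrix, extended by zero off `S` and normalized, is feasible with `X
g = 0`, which would make `kappaSq` vanish. -/
lemma isUnit_det_gram_of_kappaSq_pos {X : Matrix (Fin n) (Fin p) ℝ} {S : Finset (Fin p)}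
    {w : {j // j ∉ S} → ℝ} (h : 0 < kappaSq X S w) :
    IsUnit ((colSub X S)ᵀ * colSub X S).det := by
  classical
  rw [isUnit_iff_ne_zero]
  intro hdet
  obtain ⟨u, hu0, hu⟩ := Matrix.exists_mulVec_eq_zero_iff.2 hdet
  have hBu : colSub X S *ᵥ u = 0 := by
    have h1 : (colSub X S *ᵥ u) ⬝ᵥ (colSub X S *ᵥ u) = 0 := by
      have h2 : u ⬝ᵥ (((colSub X S)ᵀ * colSub X S) *ᵥ u) = 0 := by rw [hu, dotProduct_zero]
      rwa [← Matrix.mulVec_mulVec, Matrix.dotProduct_mulVec, Matrix.vecMul_transpose] at h2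
    exact dotProduct_self_eq_zero.1 h1
  set g : Fin p → ℝ := fun j => if hj : j ∈ S then u ⟨j, hj⟩ else 0 with hg
  have hgS : ∀ j : {j // j ∈ S}, g j = u j := fun j => by simp [hg]
  have hgoff : weightedOff S w g = 0 :=
    Finset.sum_eq_zero fun j _ => by simp [hg, j.2]
  set m := ∑ j ∈ S, |g j| with hm
  have hm' : m = ∑ j : {j // j ∈ S}, |u j| := by
    rw [hm, Finset.sum_subtype S (p := fun j => j ∈ S) (fun _ => Iff.rfl)]
    exact Finset.sum_congr rfl fun j _ => by rw [hgS]
  have hmpos : 0 < m := by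
    obtain ⟨j, hj⟩ := Function.ne_iff.1 hu0
    rw [hm']
    exact Finset.sum_pos' (fun _ _ => abs_nonneg _) ⟨j, Finset.mem_univ _, abs_pos.2 hj⟩
  have hXg : X *ᵥ g = 0 := by
    rw [← hBu]
    funext i
    simp only [Matrix.mulVec, dotProduct]
    rw [sum_eq_sum_add_sum_notMem S, Finset.sum_subtype S (p := fun j => j ∈ S) (fun _ => Iff.rfl)]
    rw [Finset.sum_eq_zero (s := (Finset.univ : Finset {j // j ∉ S}))
      (fun j _ => by simp [hg, j.2]), add_zero]
    exact Finset.sum_congr rfl fun j _ => by rw [hgS]; rfl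
  have hmem : m⁻¹ • g ∈ compatSet S w := by
    change ∑ j ∈ S, |(m⁻¹ • g) j| - weightedOff S w (m⁻¹ • g) = 1
    rw [weightedOff_smul w (inv_pos.2 hmpos).le, hgoff, mul_zero, sub_zero]
    simp only [Pi.smul_apply, smul_eq_mul, abs_mul, abs_of_pos (inv_pos.2 hmpos)]
    rw [← Finset.mul_sum, inv_mul_cancel₀ hmpos.ne']
  have hle : kappaSq X S w ≤ 0 := by
    refine (iInf₂_le _ hmem).trans (le_of_eq ?_)
    rw [Matrix.mulVec_smul, hXg]
    simp [l2norm]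
  exact absurd h (not_lt.2 hle)

/-- The projection on the span of the active columns is expressed by dual vectors, whose norms are
the `u_j`. -/
lemma exists_dual_vectors {X : Matrix (Fin n) (Fin p) ℝ} {S : Finset (Fin p)}
    (hdet : IsUnit ((colSub X S)ᵀ * colSub X S).det) :
    ∃ c : {j // j ∈ S} → EuclideanSpace ℝ (Fin n), (∀ j, ‖c j‖ = uNorm X S j) ∧
      ∀ e, (colSpan X S).starProjection e =
        ∑ j : {j // j ∈ S}, inner ℝ (c j) e • colVec X j := by
  classical
  set B := colSub X S with hB
  set G := Bᵀ * B with hG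
  -- The columns of `D` are dual to those of `B`: `B * Dᵀ` is the projection, and `Dᵀ * D = G⁻¹`
  -- identifies their norms.
  set D := B * G⁻¹ with hD
  have hGs : (G⁻¹)ᵀ = G⁻¹ := by
    rw [Matrix.transpose_nonsing_inv, hG, Matrix.transpose_mul, Matrix.transpose_transpose]
  have hDD : Dᵀ * D = G⁻¹ := by
    rw [hD, Matrix.transpose_mul, hGs, Matrix.mul_assoc, ← Matrix.mul_assoc Bᵀ, ← hG,
      Matrix.mul_nonsing_inv _ hdet, Matrix.mul_one]
  have hBD : Bᵀ * B * Dᵀ = Bᵀ := by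
    rw [← hG, hD, Matrix.transpose_mul, hGs, ← Matrix.mul_assoc, Matrix.mul_nonsing_inv _ hdet,
      Matrix.one_mul]
  refine ⟨fun j => WithLp.toLp 2 fun i => D i j, fun j => ?_, fun e => ?_⟩
  · have h : ‖WithLp.toLp 2 fun i => D i j‖ ^ 2 = G⁻¹ j j := by
      rw [EuclideanSpace.real_norm_sq_eq, ← hDD, Matrix.mul_apply]
      exact Finset.sum_congr rfl fun i _ => by rw [Matrix.transpose_apply, sq]
    rw [uNorm, ← hB, ← hG, ← h, Real.sqrt_sq (norm_nonneg _)]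
  · refine Submodule.eq_starProjection_of_mem_of_inner_eq_zero ?_ ?_
    · exact Submodule.sum_mem _ fun j _ => Submodule.smul_mem _ _
        (Submodule.subset_span (Set.mem_image_of_mem _ j.2))
    · intro y hy
      have hv : (∑ j : {j // j ∈ S}, inner ℝ (WithLp.toLp 2 fun i => D i j) e • colVec X j) =
          WithLp.toLp 2 (B *ᵥ (Dᵀ *ᵥ e.ofLp)) := by
        ext i
        simp [hB, colSub, colVec, Matrix.mulVec, dotProduct, PiLp.inner_apply, mul_comm]
      rw [hv]
      refine Submodule.span_induction ?_ ?_ ?_ ?_ hy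
      · rintro _ ⟨k, hk, rfl⟩
        have h1 : (Bᵀ *ᵥ (e.ofLp - B *ᵥ (Dᵀ *ᵥ e.ofLp))) ⟨k, hk⟩ = 0 := by
          rw [Matrix.mulVec_sub, Matrix.mulVec_mulVec, Matrix.mulVec_mulVec, hBD, sub_self]
          rfl
        rw [← h1]
        simp only [PiLp.inner_apply, Matrix.mulVec, dotProduct, colVec]
        exact Finset.sum_congr rfl fun i _ => rfl
      · exact inner_zero_right _
      · intro a b _ _ ha hb
        rw [inner_add_right, ha, hb, add_zero]
      · intro r a _ ha
        rw [inner_smul_right, ha, mul_zero]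

end LowerBound

/-! ### From the exact formula to the lower bound. -/

section Combination

variable {n p : ℕ}

/-- Counterpart of `le_rate_of_compat`: minimality of `bstar` bounds `kappaSq` from below. The free
`N` will be `‖X b(w)‖`. -/
lemma rate_le_of_minimizer (hn : 0 < n) {X : Matrix (Fin n) (Fin p) ℝ} {S : Finset (Fin p)}
    {w : {j // j ∉ S} → ℝ} {bstar : Fin p → ℝ} (hb : IsCompatMinimizer X S w bstar)
    {lam : ℝ} (hlam : 0 < lam) {N : ℝ} (hN : 0 < N) (hNle : N ≤ ‖euclideanMulVec X bstar‖) :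
    rate X S w lam ≤ ENNReal.ofReal (lam / N) := by
  have hn' : (0 : ℝ) < n := by exact_mod_cast hn
  have hScard : 0 < S.card := by
    rcases S.eq_empty_or_nonempty with rfl | h
    · have h1 : ∑ j ∈ (∅ : Finset (Fin p)), |bstar j| - weightedOff ∅ w bstar = 1 := hb.1
      have h2 : 0 ≤ weightedOff ∅ w bstar := Finset.sum_nonneg fun _ _ => abs_nonneg _
      simp only [Finset.sum_empty] at h1
      linarith
    · exact h.card_pos
  have hs' : (0 : ℝ) < S.card := by exact_mod_cast hScard
  have hkappa : ENNReal.ofReal (S.card * N ^ 2 / n) ≤ kappaSq X S w := by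
    refine le_iInf₂ fun b hbm => ENNReal.ofReal_le_ofReal ?_
    have h1 : ‖euclideanMulVec X bstar‖ ^ 2 ≤ l2norm (X *ᵥ b) ^ 2 := hb.2 hbm
    have h2 := pow_le_pow_left₀ hN.le hNle 2
    exact div_le_div_of_nonneg_right
      (mul_le_mul_of_nonneg_left (h2.trans h1) hs'.le) hn'.le
  have hdiv : (S.card : ℝ≥0∞) / kappaSq X S w ≤ ENNReal.ofReal (n / N ^ 2) := by
    refine (ENNReal.div_le_div_left hkappa _).trans (le_of_eq ?_)
    rw [← ENNReal.ofReal_natCast S.card, ← ENNReal.ofReal_div_of_pos (by positivity)]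
    congr 1
    field_simp
  calc rate X S w lam ≤ ENNReal.ofReal (√(n / N ^ 2)) * ENNReal.ofReal √(lam ^ 2 / n) := by
        unfold rate
        gcongr
        rw [Real.sqrt_eq_rpow, ← ENNReal.ofReal_rpow_of_nonneg (by positivity) (by norm_num)]
        gcongr
    _ = ENNReal.ofReal (lam / N) := by
        rw [← ENNReal.ofReal_mul (Real.sqrt_nonneg _), ← Real.sqrt_mul (by positivity)]
        congr 1
        rw [Real.sqrt_eq_iff_mul_self_eq (by positivity) (by positivity)]
        field_simp

lemma abs_real_sign_le_one (r : ℝ) : |Real.sign r| ≤ 1 := by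
  rcases Real.sign_apply_eq r with h | h | h <;> simp [h]

/-- A perturbation no larger than `|r|` cannot reverse the sign. -/
lemma sign_mul_sub_eq_abs {r a : ℝ} (h : |a| ≤ |r|) :
    Real.sign r * (r - a) = |r - a| := by
  rcases lt_trichotomy r 0 with hr | rfl | hr
  · rw [abs_of_neg hr] at h
    have := abs_le.1 h
    rw [Real.sign_of_neg hr, abs_of_nonpos (by linarith)]
    ring
  · have : a = 0 := by simpa using h
    simp [this]
  · rw [abs_of_pos hr] at h
    have := abs_le.1 h
    rw [Real.sign_of_pos hr, abs_of_nonneg (by linarith)]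
    ring

/-- The betamin condition forces the minimizers over the signed constraint sets to have positive
prediction norm, and gives the corresponding inequality between real numbers. -/
lemma Betamin.pos_and_lt {X : Matrix (Fin n) (Fin p) ℝ} {S : Finset (Fin p)} {β0 : Fin p → ℝ}
    {t lam : ℝ} (hlam : 0 < lam) {bstar : Fin p → ℝ} {b : ({j // j ∉ S} → ℝ) → Fin p → ℝ}
    (h : Betamin X S β0 t lam bstar b) {z : Fin p → ℝ} {w : {j // j ∉ S} → ℝ}
    (hw : w ∈ weightSet (vBar X S t lam)) (hb : b w ∈ signedSet S z w) :
    0 < ‖euclideanMulVec X (b w)‖ ∧ ∀ j : {j // j ∈ S},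
      lam * (|b w j| / ‖euclideanMulVec X (b w)‖ ^ 2 + uBar X S t lam j) < |β0 j| := by
  have hle : ∀ j : {j // j ∈ S}, ENNReal.ofReal lam * (ENNReal.ofReal |b w j| /
      ENNReal.ofReal (‖euclideanMulVec X (b w)‖ ^ 2) + ENNReal.ofReal (uBar X S t lam j)) <
        ENNReal.ofReal |β0 j| := by
    intro j
    refine lt_of_le_of_lt ?_ (h j).1
    gcongr
    exact le_iSup₂ (f := fun w (_ : w ∈ weightSet (vBar X S t lam)) =>
      ENNReal.ofReal |b w j| / ENNReal.ofReal (l2norm (X *ᵥ b w) ^ 2)) w hw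
  have hpos : 0 < ‖euclideanMulVec X (b w)‖ := by
    refine lt_of_le_of_ne (norm_nonneg _) fun h0 => ?_
    -- If `X b(w) = 0`, the convention `a/0 = ∞` would violate betamin unless `b(w)` vanishes on
    -- `S`, contradicting the constraint.
    have hzero : ∀ j ∈ S, b w j = 0 := by
      intro j hj
      by_contra hne
      have h1 := hle ⟨j, hj⟩
      rw [← h0, zero_pow two_ne_zero, ENNReal.ofReal_zero, ENNReal.div_zero
        (ENNReal.ofReal_pos.2 (abs_pos.2 hne)).ne', top_add,
        ENNReal.mul_top (ENNReal.ofReal_pos.2 hlam).ne'] at h1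
      exact not_top_lt h1
    have h1 : 1 ≤ ∑ j ∈ S, z j * b w j - weightedOff S w (b w) := hb
    rw [Finset.sum_eq_zero fun j hj => by rw [hzero j hj, mul_zero]] at h1
    have h2 : 0 ≤ weightedOff S w (b w) := Finset.sum_nonneg fun _ _ => abs_nonneg _
    linarith
  refine ⟨hpos, fun j => ?_⟩
  have hu : 0 ≤ uBar X S t lam j :=
    div_nonneg (mul_nonneg (Real.sqrt_nonneg _) (Real.sqrt_nonneg _)) hlam.le
  have h1 := hle j
  rw [← ENNReal.ofReal_div_of_pos (by positivity), ← ENNReal.ofReal_add (by positivity) hu,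
    ← ENNReal.ofReal_mul hlam.le,
    ENNReal.ofReal_lt_ofReal_iff_of_nonneg (by positivity)] at h1
  exact h1

/-- Deterministic lower bound for the prediction error. -/
lemma IsLasso.lower_bound (hn : 0 < n) {X : Matrix (Fin n) (Fin p) ℝ} {S : Finset (Fin p)}
    {β0 : Fin p → ℝ} (hS : ∀ j, j ∉ S → β0 j = 0) {t lam : ℝ} (hlam : 0 < lam)
    (hv : ∀ j, vBar X S t lam j < 1)
    {e : EuclideanSpace ℝ (Fin n)}
    (hη : ∀ j : {j // j ∉ S},
      |inner ℝ (e - (colSpan X S).starProjection e) (colVec X j)| ≤ lam * vBar X S t lam j)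
    {c : {j // j ∈ S} → EuclideanSpace ℝ (Fin n)}
    (hc : (colSpan X S).starProjection e = ∑ j : {j // j ∈ S}, inner ℝ (c j) e • colVec X j)
    (hce : ∀ j, |inner ℝ (c j) e| ≤ lam * uBar X S t lam j)
    {y : Fin n → ℝ} (hy : WithLp.toLp 2 y = euclideanMulVec X β0 + e)
    {bstar : Fin p → ℝ} {bw : ({j // j ∉ S} → ℝ) → Fin p → ℝ}
    (hbstar : IsCompatMinimizer X S (1 + vBar X S t lam) bstar)
    (hbw : ∀ w ∈ weightSet (vBar X S t lam),
      IsSignedMinimizer X S (fun j => Real.sign (bstar j)) w (bw w))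
    (hbeta : Betamin X S β0 t lam bstar bw) {b : Fin p → ℝ} (hb : IsLasso X y lam b) :
    (rate X S (1 + vBar X S t lam) lam : EReal) ≤
      ((l2norm (X *ᵥ (b - β0)) + ‖(colSpan X S).starProjection e‖ : ℝ) : EReal) := by
  classical
  set v := vBar X S t lam with hvdef
  -- The coefficients of the projected noise in the active columns, to be added to `β0`.
  set a : Fin p → ℝ := fun j => if hj : j ∈ S then inner ℝ (c ⟨j, hj⟩) e else 0 with ha
  have haS : ∀ j : {j // j ∈ S}, a j = inner ℝ (c j) e := fun j => by simp [ha]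
  have hPa : euclideanMulVec X a = (colSpan X S).starProjection e := by
    rw [hc, euclideanMulVec_eq_sum,
      ← Finset.sum_subset (Finset.subset_univ S) (fun j _ hj => by simp [ha, hj]),
      Finset.sum_subtype S (p := fun j => j ∈ S) (fun _ => Iff.rfl)]
    exact Finset.sum_congr rfl fun j _ => by rw [haS]
  have hβ : ∀ j, j ∉ S → (β0 + a) j = 0 := fun j hj => by simp [ha, hj, hS j hj]
  have hy' : WithLp.toLp 2 y =
      euclideanMulVec X (β0 + a) + (e - (colSpan X S).starProjection e) := by
    rw [hy, map_add, hPa]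
    abel
  have hposlt := fun w hw => hbeta.pos_and_lt hlam hw (hbw w hw).1
  obtain ⟨w, hw, hnorm⟩ := hb.exists_weight_norm_eq hβ hlam
    (fun j hj => inner_sub_starProjection_colVec_of_mem X S e hj) hv hη hy'
    (fun j => abs_real_sign_le_one (bstar j)) hbw (fun w hw => (hposlt w hw).1)
    (fun w hw j hj => by
      have h1 := (hposlt w hw).2 ⟨j, hj⟩
      have h2 := hce ⟨j, hj⟩
      rw [← haS] at h2
      rw [← (hbeta ⟨j, hj⟩).2]
      have h3 : (β0 + a) j - lam / ‖euclideanMulVec X (bw w)‖ ^ 2 * bw w j =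
          β0 j - (lam / ‖euclideanMulVec X (bw w)‖ ^ 2 * bw w j - a j) := by
        rw [Pi.add_apply]
        ring
      rw [h3]
      -- Betamin pays for two shifts of `β0 j`: the shrinkage (the `𝐛_j` term) and the projected
      -- noise (the `ū_j` term).
      refine sign_mul_sub_eq_abs ((abs_sub _ _).trans ?_)
      rw [abs_mul, abs_of_nonneg (by positivity)]
      have h4 : lam / ‖euclideanMulVec X (bw w)‖ ^ 2 * |bw w j| =
        lam * (|bw w j| / ‖euclideanMulVec X (bw w)‖ ^ 2) := by ring
      rw [h4]
      rw [mul_add] at h1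
      linarith)
  have hN := (hposlt w hw).1
  have hle : ‖euclideanMulVec X (bw w)‖ ≤ ‖euclideanMulVec X bstar‖ := by
    have hmem : bstar ∈ signedSet S (fun j => Real.sign (bstar j)) w := by
      have h1 : ∑ j ∈ S, |bstar j| - weightedOff S (1 + v) bstar = 1 := hbstar.1
      change 1 ≤ ∑ j ∈ S, Real.sign (bstar j) * bstar j - weightedOff S w bstar
      rw [← h1]
      refine sub_le_sub (Finset.sum_le_sum fun j _ => ?_) (Finset.sum_le_sum fun j _ => ?_)
      · have := sign_mul_sub_eq_abs (r := bstar j) (a := 0) (by simp)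
        rw [sub_zero] at this
        exact this.ge
      · have h2 : 0 ≤ w j := by linarith [(hw j).1, hv j]
        have h3 : w j ≤ (1 + v) j := (hw j).2
        rw [abs_mul, abs_mul, abs_of_nonneg h2, abs_of_nonneg (h2.trans h3)]
        exact mul_le_mul_of_nonneg_right h3 (abs_nonneg _)
    have h4 : ‖euclideanMulVec X (bw w)‖ ^ 2 ≤ ‖euclideanMulVec X bstar‖ ^ 2 := (hbw w hw).2 hmem
    exact (sq_le_sq₀ (norm_nonneg _) (norm_nonneg _)).1 h4
  have hrate := rate_le_of_minimizer hn hbstar hlam hN hle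
  have htri : lam / ‖euclideanMulVec X (bw w)‖ ≤
      l2norm (X *ᵥ (b - β0)) + ‖(colSpan X S).starProjection e‖ := by
    rw [← hnorm, ← hPa, l2norm_mulVec, ← sub_sub, map_sub]
    exact norm_sub_le _ _
  calc (rate X S (1 + v) lam : EReal)
      ≤ (ENNReal.ofReal (lam / ‖euclideanMulVec X (bw w)‖) : EReal) :=
        EReal.coe_ennreal_le_coe_ennreal_iff.2 hrate
    _ = ((lam / ‖euclideanMulVec X (bw w)‖ : ℝ) : EReal) := by
        rw [EReal.coe_ennreal_ofReal, max_eq_left (by positivity)]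
    _ ≤ _ := by exact_mod_cast htri

lemma abs_inner_sub_starProjection_le {X : Matrix (Fin n) (Fin p) ℝ} {S : Finset (Fin p)}
    {t lam : ℝ} (hlam : 0 < lam) {e : EuclideanSpace ℝ (Fin n)} (j : {j // j ∉ S})
    (h : |inner ℝ (colVec X j - (colSpan X S).starProjection (colVec X j)) e| ≤
      ‖colVec X j - (colSpan X S).starProjection (colVec X j)‖ * noiseLevel p t) :
    |inner ℝ (e - (colSpan X S).starProjection e) (colVec X j)| ≤ lam * vBar X S t lam j := by
  rw [inner_sub_starProjection_comm]
  refine h.trans (le_of_eq ?_)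
  rw [vBar, mul_div_cancel₀ _ hlam.ne', vNorm]

end Combination

end LassoBounds

/-! ### Assembling the event and the deterministic bounds. -/

theorem mainTheorem8 {n p : ℕ} (hn : 0 < n)
    (X : Matrix (Fin n) (Fin p) ℝ) (β0 : Fin p → ℝ)
    {Ω : Type*} [MeasurableSpace Ω] (P : Measure Ω) [IsProbabilityMeasure P]
    (ε : Fin n → Ω → ℝ)
    (hlaw : ∀ i, HasLaw (ε i) (gaussianReal 0 1) P) (hind : iIndepFun ε P)
    (Y : Ω → Fin n → ℝ) (hY : ∀ ω, Y ω = X *ᵥ β0 + fun i => ε i ω)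
    (S0 : Finset (Fin p)) (hS0 : S0 = activeSet β0)
    (t lam : ℝ) (ht : 0 < t) (hlam : 0 < lam)
    (hlamv : ∀ j, vNorm X S0 j * noiseLevel p t < lam) :
    -- the upper bound
    (∀ x : ℝ, 0 < x →
      ∃ T : Set Ω, MeasurableSet T ∧ 1 - Real.exp (-t) - Real.exp (-x) ≤ P.real T ∧
        ∀ ω ∈ T,
          (∃ b, IsLasso X (Y ω) lam b) ∧
          ∀ b, IsLasso X (Y ω) lam b →
            ((l2norm (X *ᵥ (b - β0)) : ℝ) : EReal) ≤
              (rate X S0 (1 - vBar X S0 t lam) lam : EReal)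
                + (√(S0.card : ℝ) : ℝ) + (√(2 * x) : ℝ)) ∧
    -- the upper and the lower bound jointly, under the betamin condition
    (∀ (bstar : Fin p → ℝ) (bw : ({j // j ∉ S0} → ℝ) → Fin p → ℝ),
      0 < kappaSq X S0 (1 + vBar X S0 t lam) →
      IsCompatMinimizer X S0 (1 + vBar X S0 t lam) bstar →
      (∀ w ∈ weightSet (vBar X S0 t lam),
        IsSignedMinimizer X S0 (fun j => Real.sign (bstar j)) w (bw w)) →
      Betamin X S0 β0 t lam bstar bw →
      ∀ x : ℝ, 0 < x →
        ∃ T : Set Ω, MeasurableSet T ∧ 1 - Real.exp (-t) - Real.exp (-x) ≤ P.real T ∧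
          ∀ ω ∈ T,
            (∃ b, IsLasso X (Y ω) lam b) ∧
            ∀ b, IsLasso X (Y ω) lam b →
              IsKKT X (Y ω) lam b ∧
              (rate X S0 (1 + vBar X S0 t lam) lam : EReal)
                  - (√(S0.card : ℝ) : ℝ) - (√(2 * x) : ℝ) ≤
                ((l2norm (X *ᵥ (b - β0)) : ℝ) : EReal) ∧
              ((l2norm (X *ᵥ (b - β0)) : ℝ) : EReal) ≤
                (rate X S0 (1 - vBar X S0 t lam) lam : EReal)
                  + (√(S0.card : ℝ) : ℝ) + (√(2 * x) : ℝ))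
 := by
  classical
  have hS : ∀ j, j ∉ S0 → β0 j = 0 := fun j hj => eq_zero_of_notMem_activeSet (hS0 ▸ hj)
  have hv : ∀ j, vBar X S0 t lam j < 1 := fun j => (div_lt_one hlam).2 (hlamv j)
  have hY' : ∀ ω, WithLp.toLp 2 (Y ω) = euclideanMulVec X β0 + WithLp.toLp 2 fun i => ε i ω :=
    fun ω => by rw [hY]; rfl
  have hupper : ∀ {ω : Ω} {x : ℝ}, (∀ j : {j // j ∉ S0},
      |inner ℝ ((WithLp.toLp 2 fun i => ε i ω) -
        (colSpan X S0).starProjection (WithLp.toLp 2 fun i => ε i ω)) (colVec X j)| ≤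
          lam * vBar X S0 t lam j) →
      ‖(colSpan X S0).starProjection (WithLp.toLp 2 fun i => ε i ω)‖ ≤ √S0.card + √(2 * x) →
      ∀ b, IsLasso X (Y ω) lam b → ((l2norm (X *ᵥ (b - β0)) : ℝ) : EReal) ≤
        (rate X S0 (1 - vBar X S0 t lam) lam : EReal)
          + (√(S0.card : ℝ) : ℝ) + (√(2 * x) : ℝ) := by
    intro ω x hη hP b hb
    refine (hb.upper_bound hn hS hlam (fun j => (hv j).le) hη (hY' ω)).trans ?_
    rw [add_assoc, ← EReal.coe_add]
    gcongr
  constructor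
  · intro x hx
    obtain ⟨T, hT, hprob, hevent⟩ := exists_noise_event hlaw hind
      (fun j => colVec X j - (colSpan X S0).starProjection (colVec X j))
      (colSpan X S0) (finrank_colSpan_le X S0) ht hx
    refine ⟨T, hT, hprob, fun ω hω => ⟨exists_isLasso X (Y ω) hlam, ?_⟩⟩
    obtain ⟨hlin, hP⟩ := hevent ω hω
    exact hupper (fun j => abs_inner_sub_starProjection_le hlam j (hlin j)) hP
  · intro bstar bw hkappa hbstar hbw hbeta x hx
    obtain ⟨c, hcnorm, hc⟩ := exists_dual_vectors (isUnit_det_gram_of_kappaSq_pos hkappa)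
    -- One functional per column, dual vectors on `S0` and residual columns off it, so the union
    -- bound still has only `p` terms and costs a single `exp(-t)`.
    obtain ⟨T, hT, hprob, hevent⟩ := exists_noise_event hlaw hind
      (fun j => if hj : j ∈ S0 then c ⟨j, hj⟩ else
        colVec X j - (colSpan X S0).starProjection (colVec X j))
      (colSpan X S0) (finrank_colSpan_le X S0) ht hx
    refine ⟨T, hT, hprob, fun ω hω => ⟨exists_isLasso X (Y ω) hlam, fun b hb => ?_⟩⟩
    obtain ⟨hlin, hP⟩ := hevent ω hω
    have hη : ∀ j : {j // j ∉ S0},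
        |inner ℝ ((WithLp.toLp 2 fun i => ε i ω) -
          (colSpan X S0).starProjection (WithLp.toLp 2 fun i => ε i ω)) (colVec X j)| ≤
            lam * vBar X S0 t lam j := fun j => by
      have h := hlin j
      rw [dif_neg j.2] at h
      exact abs_inner_sub_starProjection_le hlam j h
    have hce : ∀ j : {j // j ∈ S0}, |inner ℝ (c j) (WithLp.toLp 2 fun i => ε i ω)| ≤
        lam * uBar X S0 t lam j := fun j => by
      have h := hlin j
      rw [dif_pos j.2, hcnorm] at h
      rwa [uBar, mul_div_cancel₀ _ hlam.ne']
    refine ⟨?_, ?_, hupper hη hP b hb⟩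
    · obtain ⟨ζ, h1, h2, h3⟩ := hb.exists_subgradient hlam
      exact isKKT_of_subgradient h1 h2 h3
    · have h := hb.lower_bound hn hS hlam hv hη (hc _) hce (hY' ω) hbstar hbw hbeta
      rw [EReal.sub_le_iff_le_add (by simp) (by simp), EReal.sub_le_iff_le_add (by simp) (by simp),
        ← EReal.coe_add, ← EReal.coe_add]
      refine h.trans ?_
      norm_cast
      linarith
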